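/- A priced timed automaton with a finite set $X$ of clocks, one cost function and atomic propositions $\mathrm{AP}$ consists of a finite set $Q$ of locations with an initial location $q_0$; a finite set $E$ of transitions $(q,g,R,q')$, where $q,q'\in Q$, $R\subseteq X$ and $g$ is a guard, i.e. a finite (non-empty) conjunction of constraints $x\sim c$ with $x\in X$, $c\in\mathbb N$, ${\sim}\in\{<,\le,=,\ge,>\}$; an invariant (again such a conjunction) for every location; a cost function $\mathrm{cost}\colon Q\cup E\to\mathbb N$; and a labelling $\ell\colon Q\to 2^{\mathrm{AP}}$. Its states are the pairs $(q,v)$ with $v\colon X\to\mathbb R_{\ge 0}$ satisfying the invariant of $q$. A mixed move $(q,v)\xrightarrow{t,e}(q',v')$, where $t\in\mathbb R_{\ge0}$ and $e=(q,g,R,q')\in E$, requires that $v+t'$ satisfies the invariant of $q$ for all $0\le t'\le t$, that $v+t$ satisfies $g$, that $v'$ is obtained from $v+t$ by setting the clocks in $R$ to $0$, and that $v'$ satisfies the invariant of $q'$; its cost is $t\cdot\mathrm{cost}(q)+\mathrm{cost}(e)$. The automaton is non-blocking if $(q_0,0)$ is a state and every state has an outgoing mixed move. A finite run $\varrho$ is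 a finite sequence of $|\varrho|\ge 0$ consecutive mixed moves, and its cost is the sum of their costs; $\varrho_{\le\pi}$ and $\varrho_{\ge\pi}$ denote the parts of $\varrho$ up to, and from, position $\pi$. Formulas of WMTL are given by $\varphi::=a\mid\neg\varphi\mid\varphi\vee\varphi\mid\varphi\,\mathbf U_{\sim c}\,\varphi$ with $a\in\mathrm{AP}$, $c\in\mathbb N$, ${\sim}\in\{<,\le,=,\ge,>\}$. On finite runs, $\varrho\models a$ iff $a$ labels the first location of $\varrho$; $\neg$ and $\vee$ are as usual; and $\varrho\models\varphi_1\mathbf U_{\sim c}\varphi_2$ iff there is a position $0<\pi\le|\varrho|$ such that $\varrho_{\ge\pi}\models\varphi_2$, $\varrho_{\ge\pi'}\models\varphi_1$ for all $0<\pi'<\pi$, and $\mathrm{cost}(\varrho_{\le\pi})\sim c$. **Theorem.** Let $\mathrm{AP}$ be any fixed finite non-empty set of atomic propositions. The following problem is undecidable: given a non-blocking priced timed automaton $\mathcal A$ with exactly one clock and one cost function, labelled over $\mathrm{AP}$, and a WMTL formula $\varphi$ over $\mathrm{AP}$, decide whether there is a finite run $\varrho$ of $\mathcal A$ starting in $(q_0,0)$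 with $\varrho\models\varphi$. That is, no total computable function returns the correct answer on (a standard encoding of) every such pair $(\mathcal A,\varphi)$. -/

import Mathlib

open scoped NNReal

namespace Priced

/-! ## Comparison operators and clock constraints -/

/-- The comparison operators `<, ≤, =, ≥, >`. -/
inductive Cmp where
  | lt | le | eq | ge | gt

/-- `r.Holds a c` is the comparison `a r c` of a nonnegative real with a natural number. -/
def Cmp.Holds : Cmp → ℝ≥0 → ℕ → Prop
  | .lt, a, c => a < c
  | .le, a, c => a ≤ c
  | .eq, a, c => a = c
  | .ge, a, c => (c : ℝ≥0) ≤ a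
  | .gt, a, c => (c : ℝ≥0) < a

/-- Clock constraints over `k` clocks: `g ::= x ∼ c | g ∧ g`. -/
inductive Guard (k : ℕ) where
  | atom (x : Fin k) (r : Cmp) (c : ℕ)
  | and (g h : Guard k)

/-- A valuation of `k` clocks. -/
abbrev Valuation (k : ℕ) := Fin k → ℝ≥0

/-- `g.Sat v` means that the valuation `v` satisfies the constraint `g`. -/
def Guard.Sat {k : ℕ} : Guard k → Valuation k → Prop
  | .atom x r c, v => r.Holds (v x) c
  | .and g h, v => g.Sat v ∧ h.Sat v

/-- The valuation `v + t`. -/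
def Valuation.delay {k : ℕ} (v : Valuation k) (t : ℝ≥0) : Valuation k := fun x => v x + t

/-- The valuation `[R ← 0]v`. -/
def Valuation.reset {k : ℕ} (R : Finset (Fin k)) (v : Valuation k) : Valuation k :=
  fun x => if x ∈ R then 0 else v x

/-! ## Priced timed automata -/

/-- Transitions `(q, g, R, q')` over `n` locations and `k` clocks. -/
structure Edge (n k : ℕ) where
  src : Fin n
  guard : Guard k
  reset : Finset (Fin k)
  tgt : Fin n

/-- Labeled priced timed automata with `k` clocks and `p` cost functions, over the atomic
propositions `Fin m`. The finite set of transitions is listed without repetition. -/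
structure PTA (k p m : ℕ) where
  numLocs : ℕ
  init : Fin numLocs
  numEdges : ℕ
  edge : Fin numEdges → Edge numLocs k
  edge_injective : Function.Injective edge
  inv : Fin numLocs → Guard k
  locCost : Fin p → Fin numLocs → ℕ
  edgeCost : Fin p → Fin numEdges → ℕ
  label : Fin numLocs → Finset (Fin m)

namespace PTA

variable {k p m : ℕ}

/-- Configurations: a location together with a clock valuation. -/
abbrev Config (A : PTA k p m) := Fin A.numLocs × Valuation k

/-- The initial state: the initial location with all clocks zero. -/
def start (A : PTA k p m) : A.Config := (A.init, fun _ => 0)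

/-- The delay move `s --t--> s'`. -/
def DelayMove (A : PTA k p m) (s : A.Config) (t : ℝ≥0) (s' : A.Config) : Prop :=
  s' = (s.1, s.2.delay t) ∧ ∀ t' ≤ t, (A.inv s.1).Sat (s.2.delay t')

/-- The discrete move `s --e--> s'`. -/
def DiscreteMove (A : PTA k p m) (s : A.Config) (e : Fin A.numEdges) (s' : A.Config) : Prop :=
  s.1 = (A.edge e).src ∧ (A.edge e).guard.Sat s.2 ∧
    s' = ((A.edge e).tgt, s.2.reset (A.edge e).reset) ∧ (A.inv s'.1).Sat s'.2

/-- The mixed move `s --t,e--> s'`: a delay move followed by a discrete move. -/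
def MixedMove (A : PTA k p m) (s : A.Config) (t : ℝ≥0) (e : Fin A.numEdges) (s' : A.Config) :
    Prop :=
  ∃ u, A.DelayMove s t u ∧ A.DiscreteMove u e s'

/-- The states of the transition system are the configurations satisfying the invariant of their
location; the automaton is non-blocking if the initial configuration is a state and every state
has an outgoing mixed move. -/
def NonBlocking (A : PTA k p m) : Prop :=
  (A.inv A.start.1).Sat A.start.2 ∧
    ∀ s : A.Config, (A.inv s.1).Sat s.2 → ∃ t e s', A.MixedMove s t e s'

/-- Finite runs `s₀ --t₁,e₁--> s₁ ⋯ --tₙ,eₙ--> sₙ`. -/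
structure Run (A : PTA k p m) where
  length : ℕ
  state : Fin (length + 1) → A.Config
  delay : Fin length → ℝ≥0
  edge : Fin length → Fin A.numEdges
  move : ∀ i, A.MixedMove (state i.castSucc) (delay i) (edge i) (state i.succ)

namespace Run

variable {A : PTA k p m}

/-- The `i`-th cost of a run: the sum of the costs of its mixed moves, where a mixed move costs
delay times the rate of the location plus the price of the transition. -/
def cost (i : Fin p) (ρ : A.Run) : ℝ≥0 :=
  ∑ j : Fin ρ.length,
    (ρ.delay j * A.locCost i (ρ.state j.castSucc).1 + A.edgeCost i (ρ.edge j))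

/-- The finite piece of `ρ` ending at position `π`. -/
def upTo (ρ : A.Run) (π : Fin (ρ.length + 1)) : A.Run where
  length := π
  state j := ρ.state ⟨j, by omega⟩
  delay j := ρ.delay ⟨j, by omega⟩
  edge j := ρ.edge ⟨j, by omega⟩
  move j := ρ.move ⟨j, by omega⟩

/-- The piece of `ρ` starting at position `π`. -/
def startingAt (ρ : A.Run) (π : Fin (ρ.length + 1)) : A.Run where
  length := ρ.length - π
  state j := ρ.state ⟨π + j, by omega⟩
  delay j := ρ.delay ⟨π + j, by omega⟩
  edge j := ρ.edge ⟨π + j, by omega⟩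
  move j := ρ.move ⟨π + j, by omega⟩

end Run

end PTA

/-! ## The logic WMTL -/

/-- WMTL formulas over the atomic propositions `Fin m` and `p` cost functions:
`φ ::= a | ¬φ | φ ∨ φ | φ U_{cost ∼ c} φ`. -/
inductive WMTL (p m : ℕ) where
  | atom (a : Fin m)
  | not (φ : WMTL p m)
  | or (φ ψ : WMTL p m)
  | untl (φ : WMTL p m) (i : Fin p) (r : Cmp) (c : ℕ) (ψ : WMTL p m)

/-- Satisfaction of a WMTL formula by a finite run (pointwise semantics, strict until). -/
def WMTL.Sat {k p m : ℕ} {A : PTA k p m} : WMTL p m → A.Run → Prop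
  | .atom a, ρ => a ∈ A.label (ρ.state 0).1
  | .not φ, ρ => ¬ φ.Sat ρ
  | .or φ ψ, ρ => φ.Sat ρ ∨ ψ.Sat ρ
  | .untl φ i r c ψ, ρ => ∃ π : Fin (ρ.length + 1), 0 < π ∧ ψ.Sat (ρ.startingAt π) ∧
      (∀ π' : Fin (ρ.length + 1), 0 < π' → π' < π → φ.Sat (ρ.startingAt π')) ∧
      r.Holds ((ρ.upTo π).cost i) c

/-- Existential model checking: some finite run from the initial state satisfies the formula. -/
def PTA.Models {k p m : ℕ} (A : PTA k p m) (φ : WMTL p m) : Prop :=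
  ∃ ρ : A.Run, ρ.state 0 = A.start ∧ φ.Sat ρ

/-! ## Encoding instances as finite words over `ℕ` -/

/-- Concatenation of the words `f 0, …, f (n - 1)`. -/
def word {n : ℕ} (f : Fin n → List ℕ) : List ℕ := (List.ofFn f).flatten

def Cmp.code : Cmp → ℕ
  | .lt => 0
  | .le => 1
  | .eq => 2
  | .ge => 3
  | .gt => 4

/-- Constraints in Polish notation. -/
def Guard.code {k : ℕ} : Guard k → List ℕ
  | .atom x r c => [0, x, r.code, c]
  | .and g h => 1 :: (g.code ++ h.code)

/-- The characteristic word of a subset of `Fin n`. -/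
def subsetCode {n : ℕ} (S : Finset (Fin n)) : List ℕ := word fun x => [if x ∈ S then 1 else 0]

def Edge.code {n k : ℕ} (e : Edge n k) : List ℕ :=
  (e.src : ℕ) :: (e.tgt : ℕ) :: (e.guard.code ++ subsetCode e.reset)

/-- An automaton is written as a list of all its data. -/
def PTA.code {k p m : ℕ} (A : PTA k p m) : List ℕ :=
  A.numLocs :: (A.init : ℕ) :: A.numEdges ::
    ((word fun q => (A.inv q).code ++ subsetCode (A.label q) ++ word fun i => [A.locCost i q]) ++
      word fun e => (A.edge e).code ++ word fun i => [A.edgeCost i e])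

/-- Formulas in Polish notation. -/
def WMTL.code {p m : ℕ} : WMTL p m → List ℕ
  | .atom a => [0, a]
  | .not φ => 1 :: φ.code
  | .or φ ψ => 2 :: (φ.code ++ ψ.code)
  | .untl φ i r c ψ => 3 :: (i : ℕ) :: r.code :: c :: (φ.code ++ ψ.code)

/-- Instances of the model-checking problem: a non-blocking labeled priced timed automaton with
`k` clocks and `p` cost functions, and a formula, over `m` atomic propositions. -/
def Instance (k p m : ℕ) := {A : PTA k p m // A.NonBlocking} × WMTL p m

def Instance.code {k p m : ℕ} (I : Instance k p m) : List ℕ := I.1.1.code ++ I.2.code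

/-- The decision problem `P` on the type `α`, whose elements are encoded as finite words over `ℕ`,
is decidable: some total computable function on words gives the right answer on the code of every
instance (with no requirement on words that are not codes). -/
def AlgorithmicallyDecidable {α : Type*} (code : α → List ℕ) (P : α → Prop) : Prop :=
  ∃ f : List ℕ → Bool, Computable f ∧ ∀ a, f (code a) = true ↔ P a

/-! ## The encoding is injective -/

theorem Cmp.code_injective : Function.Injective Cmp.code := by
  intro a b h
  cases a <;> cases b <;> simp_all [Cmp.code]

theorem word_append_inj {n : ℕ} {α : Type*} (enc : α → List ℕ)
    (henc : ∀ a b l l', enc a ++ l = enc b ++ l' → a = b ∧ l = l') (f g : Fin n → α)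
    (l l' : List ℕ) (h : (word fun i => enc (f i)) ++ l = (word fun i => enc (g i)) ++ l') :
    f = g ∧ l = l' := by
  induction n generalizing l l' with
  | zero => exact ⟨Subsingleton.elim _ _, by simpa [word] using h⟩
  | succ n ih =>
    simp only [word, List.ofFn_succ, List.flatten_cons, List.append_assoc] at h
    obtain ⟨h0, h1⟩ := henc _ _ _ _ h
    obtain ⟨h2, h3⟩ := ih (fun i => f i.succ) (fun i => g i.succ) l l' h1
    refine ⟨?_, h3⟩
    funext i
    refine Fin.cases h0 (fun j => congrFun h2 j) i

theorem natWord_append_inj {n : ℕ} (f g : Fin n → ℕ) (l l' : List ℕ)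
    (h : (word fun i => [f i]) ++ l = (word fun i => [g i]) ++ l') : f = g ∧ l = l' :=
  word_append_inj (fun a : ℕ => [a]) (by simp) f g l l' h

theorem subsetCode_append_inj {n : ℕ} (S T : Finset (Fin n)) (l l' : List ℕ)
    (h : subsetCode S ++ l = subsetCode T ++ l') : S = T ∧ l = l' := by
  obtain ⟨h1, h2⟩ := natWord_append_inj _ _ _ _ h
  refine ⟨?_, h2⟩
  ext x
  have := congrFun h1 x
  by_cases hS : x ∈ S <;> by_cases hT : x ∈ T <;> simp_all

theorem Guard.code_append_inj {k : ℕ} (g h : Guard k) (l l' : List ℕ)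
    (e : g.code ++ l = h.code ++ l') : g = h ∧ l = l' := by
  induction g generalizing h l l' with
  | atom x r c =>
    cases h with
    | atom x' r' c' =>
      simp only [Guard.code, List.cons_append, List.nil_append, List.cons.injEq] at e
      obtain ⟨-, h1, h2, h3, h4⟩ := e
      rw [Fin.ext h1, Cmp.code_injective h2, h3]
      exact ⟨rfl, h4⟩
    | and => simp [Guard.code] at e
  | and g₁ g₂ ih₁ ih₂ =>
    cases h with
    | atom => simp [Guard.code] at e
    | and h₁ h₂ =>
      simp only [Guard.code, List.cons_append, List.append_assoc, List.cons.injEq,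
        true_and] at e
      obtain ⟨h1, e'⟩ := ih₁ _ _ _ e
      obtain ⟨h2, e''⟩ := ih₂ _ _ _ e'
      exact ⟨by rw [h1, h2], e''⟩

theorem Edge.code_append_inj {n k : ℕ} (d e : Edge n k) (l l' : List ℕ)
    (h : d.code ++ l = e.code ++ l') : d = e ∧ l = l' := by
  obtain ⟨s, g, R, t⟩ := d
  obtain ⟨s', g', R', t'⟩ := e
  simp only [Edge.code, List.cons_append, List.append_assoc, List.cons.injEq] at h
  obtain ⟨h1, h2, h3⟩ := h
  obtain ⟨h4, h5⟩ := Guard.code_append_inj _ _ _ _ h3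
  obtain ⟨h6, h7⟩ := subsetCode_append_inj _ _ _ _ h5
  exact ⟨by rw [Fin.ext h1, Fin.ext h2, h4, h6], h7⟩

theorem PTA.code_append_inj {k p m : ℕ} (A B : PTA k p m) (l l' : List ℕ)
    (h : A.code ++ l = B.code ++ l') : A = B ∧ l = l' := by
  obtain ⟨n, q, N, ed, hed, iv, lc, ec, lb⟩ := A
  obtain ⟨n', q', N', ed', hed', iv', lc', ec', lb'⟩ := B
  simp only [PTA.code, List.cons_append, List.append_assoc, List.cons.injEq] at h
  obtain ⟨rfl, hq, rfl, h⟩ := h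
  have hq := Fin.ext hq
  subst hq
  obtain ⟨h1, h⟩ := word_append_inj
    (fun a : Guard k × Finset (Fin m) × (Fin p → ℕ) =>
      a.1.code ++ (subsetCode a.2.1 ++ word fun i => [a.2.2 i]))
    (by
      rintro ⟨a, b, c⟩ ⟨a', b', c'⟩ l l' h
      simp only [List.append_assoc] at h
      obtain ⟨rfl, h₁⟩ := Guard.code_append_inj _ _ _ _ h
      obtain ⟨rfl, h₂⟩ := subsetCode_append_inj _ _ _ _ h₁
      obtain ⟨rfl, h₃⟩ := natWord_append_inj _ _ _ _ h₂
      exact ⟨rfl, h₃⟩)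
    (fun q => (iv q, lb q, fun i => lc i q)) (fun q => (iv' q, lb' q, fun i => lc' i q)) _ _ h
  obtain ⟨h2, hl⟩ := word_append_inj
    (fun a : Edge n k × (Fin p → ℕ) => a.1.code ++ word fun i => [a.2 i])
    (by
      rintro ⟨a, c⟩ ⟨a', c'⟩ l l' h
      simp only [List.append_assoc] at h
      obtain ⟨rfl, h₁⟩ := Edge.code_append_inj _ _ _ _ h
      obtain ⟨rfl, h₂⟩ := natWord_append_inj _ _ _ _ h₁
      exact ⟨rfl, h₂⟩)
    (fun e => (ed e, fun i => ec i e)) (fun e => (ed' e, fun i => ec' i e)) _ _ h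
  have a1 : iv = iv' := funext fun q => congrArg (·.1) (congrFun h1 q)
  have a2 : lb = lb' := funext fun q => congrArg (·.2.1) (congrFun h1 q)
  have a3 : lc = lc' := funext fun i => funext fun q =>
    congrFun (congrArg (·.2.2) (congrFun h1 q)) i
  have a4 : ed = ed' := funext fun e => congrArg (·.1) (congrFun h2 e)
  have a5 : ec = ec' := funext fun i => funext fun e =>
    congrFun (congrArg (·.2) (congrFun h2 e)) i
  subst a1 a2 a3 a4 a5
  exact ⟨rfl, hl⟩

theorem WMTL.code_append_inj {p m : ℕ} (φ ψ : WMTL p m) (l l' : List ℕ)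
    (e : φ.code ++ l = ψ.code ++ l') : φ = ψ ∧ l = l' := by
  induction φ generalizing ψ l l' with
  | atom a =>
    cases ψ <;> simp [WMTL.code] at e
    exact ⟨by rw [Fin.ext e.1], e.2⟩
  | not φ ih =>
    cases ψ <;> simp [WMTL.code] at e
    obtain ⟨h₁, h₂⟩ := ih _ _ _ e
    exact ⟨by rw [h₁], h₂⟩
  | or φ₁ φ₂ ih₁ ih₂ =>
    cases ψ <;> simp [WMTL.code] at e
    obtain ⟨h₁, e'⟩ := ih₁ _ _ _ e
    obtain ⟨h₂, e''⟩ := ih₂ _ _ _ e'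
    exact ⟨by rw [h₁, h₂], e''⟩
  | untl φ₁ i r c φ₂ ih₁ ih₂ =>
    cases ψ with
    | untl =>
      simp only [WMTL.code, List.cons_append, List.append_assoc, List.cons.injEq, true_and] at e
      obtain ⟨h1, h2, h3, e'⟩ := e
      obtain ⟨h4, e''⟩ := ih₁ _ _ _ e'
      obtain ⟨h5, e3⟩ := ih₂ _ _ _ e''
      exact ⟨by rw [Fin.ext h1, Cmp.code_injective h2, h3, h4, h5], e3⟩
    | _ => simp [WMTL.code] at e

theorem Instance.code_injective {k p m : ℕ} :
    Function.Injective (Instance.code : Instance k p m → List ℕ) := by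
  rintro ⟨⟨A, hA⟩, φ⟩ ⟨⟨B, hB⟩, ψ⟩ h
  obtain ⟨h1, h2⟩ := PTA.code_append_inj A B φ.code ψ.code h
  obtain ⟨h3, -⟩ := WMTL.code_append_inj φ ψ [] [] (by rw [h2])
  subst h1 h3
  rfl

end Priced

/-!
The halting problem is reduced to model checking in two stages.

*From programs to queues of counters.* Every partial recursive function is computed by a
nondeterministic counter program (`computes_of_partrec`), whose control graph (`Prog.reach_iff`)
is turned into a `QueueMachine`: a finite graph that visits its counters in cyclic order, so that
every node takes the value written `K` nodes ago and appends a new one. The machine starts with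
all counters `0`, creates its input by counting marked nodes, and accepts `n + 1` exactly if the
function is defined at `n` (`exists_queueMachine`).

*From queues of counters to runs.* A counter value `n` is stored as the delay `2⁻ⁿ`. The clock is
needed for every delay anew, so old values have to be remembered by the cost. Every node of the
queue machine becomes a sequence of six locations, called phases, with cost rates `2, 1, 1, 0, 1,
1`. The clock is reset when it reaches `1` at the end of the phases `1`, `3` and `5`, so that the
delays of the phases are `d, 1 - d, e, 1 - e, f, 1 - f`. All prices of transitions are natural
numbers; hence the costs accumulated after the phases `0, …, 5` are `2 d, d, d + e, d + e, d + e +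
f, d + e` modulo `1`. Prices are three times the number of the source location, and the delay
contributes at most `2` to the cost of a move, so the cost of the next move tells a formula the
current location, without any use of labels. A formula can demand that the cost between two
locations is one of finitely many natural numbers, that is, that the costs accumulated there agree
modulo `1`. In this way it demands `d + e = 1` (using that `d ≤ 1 / 2`), which makes the cost of
every node an integer, and then that `f` is the delay of the same counter `K` nodes before, or
half of it, or twice as much: an increment has `f = d` and `2 d` equal to the old value, a
decrement has `f = 2 d` and `d` equal to the old value. As all these numbers lie in `(0, 1]`,
equality modulo `1` means equality.

Therefore the traces satisfying the formula are the encodings of accepting executions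
(`QueueMachine.models_formula_iff`; its two directions are `accepts_of_traceSat` and
`exists_trace_of_accepts`). For a fixed queue machine, the automaton is fixed too, and the formula
depends on the input only through the number of repetitions of a fixed piece that counts marked
nodes. So the reduction is computable (`QueueMachine.computable_code_toInstance`). A machine for
the universal function then gives the undecidability.
-/

namespace Priced

/-! ### Counter programs -/

/-- What a single instruction does to a single counter. -/
inductive Op where
  | nop | inc | dec | zero
  deriving DecidableEq

instance : Finite Op :=
  Finite.of_surjective (fun i : Fin 4 => ![Op.nop, .inc, .dec, .zero] i) fun o => by
    cases o
    exacts [⟨0, rfl⟩, ⟨1, rfl⟩, ⟨2, rfl⟩, ⟨3, rfl⟩]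

/-- `o.Rel x y` means that `o` may change the counter value `x` into `y`. The operation `zero` is a
test, and `dec` blocks on the value `0`. -/
def Op.Rel : Op → ℕ → ℕ → Prop
  | .nop, x, y => y = x
  | .inc, x, y => y = x + 1
  | .dec, x, y => x = y + 1
  | .zero, x, y => x = 0 ∧ y = 0

/-- Nondeterministic counter programs: regular expressions (without choice) over instructions. -/
inductive Prog where
  | basic (r : ℕ) (o : Op)
  | seq (p q : Prog)
  | star (p : Prog)

namespace Prog

/-- The relation between counter contents before and after a run of the program. -/
def Rel : Prog → (ℕ → ℕ) → (ℕ → ℕ) → Prop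
  | basic r o, s, t => o.Rel (s r) (t r) ∧ ∀ r' ≠ r, t r' = s r'
  | seq p q, s, t => ∃ u, p.Rel s u ∧ q.Rel u t
  | star p, s, t => Relation.ReflTransGen p.Rel s t

open Function

theorem rel_inc {r : ℕ} {s t : ℕ → ℕ} : (basic r .inc).Rel s t ↔ t = update s r (s r + 1) := by
  simp only [Rel, Op.Rel, funext_iff, update_apply]
  refine ⟨fun h j => ?_, fun h => ⟨by simpa using h r, fun j hj => by simpa [hj] using h j⟩⟩
  split_ifs with hj
  · rw [hj, h.1]
  · exact h.2 j hj

theorem rel_nop {r : ℕ} {s t : ℕ → ℕ} : (basic r .nop).Rel s t ↔ t = s := by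
  simp only [Rel, Op.Rel, funext_iff]
  refine ⟨fun h j => ?_, fun h => ⟨h r, fun j _ => h j⟩⟩
  by_cases hj : j = r
  · rw [hj, h.1]
  · exact h.2 j hj

theorem rel_dec {r : ℕ} {s t : ℕ → ℕ} :
    (basic r .dec).Rel s t ↔ 0 < s r ∧ t = update s r (s r - 1) := by
  simp only [Rel, Op.Rel, funext_iff, update_apply]
  refine ⟨fun h => ⟨by omega, fun j => ?_⟩, fun h => ⟨?_, fun j hj => by simpa [hj] using h.2 j⟩⟩
  · split_ifs with hj
    · rw [hj]; omega
    · exact h.2 j hj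
  · have := h.2 r
    simp at this
    omega

theorem rel_zero {r : ℕ} {s t : ℕ → ℕ} : (basic r .zero).Rel s t ↔ s r = 0 ∧ t = s := by
  simp only [Rel, Op.Rel, funext_iff]
  refine ⟨fun h => ⟨h.1.1, fun j => ?_⟩, fun h => ⟨⟨h.1, by rw [h.2, h.1]⟩, fun j _ => h.2 j⟩⟩
  by_cases hj : j = r
  · rw [hj, h.1.1, h.1.2]
  · exact h.2 j hj

theorem rel_seq {p q : Prog} {s t : ℕ → ℕ} : (seq p q).Rel s t ↔ ∃ u, p.Rel s u ∧ q.Rel u t :=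
  Iff.rfl

/-- `while a ≠ 0 do (a := a - 1; body)`. -/
def loop (a : ℕ) (body : Prog) : Prog :=
  seq (star (seq (basic a .dec) body)) (basic a .zero)

/-- A loop passes through the states `S 0, …, S k` if its body leads from `S j` (with `a`
decremented) to `S (j + 1)` and nowhere else. -/
theorem loop_rel {a : ℕ} {body : Prog} (k : ℕ) (S : ℕ → ℕ → ℕ) (ha : ∀ j ≤ k, S j a = k - j)
    (hb : ∀ j < k, ∀ t, body.Rel (update (S j) a (S j a - 1)) t ↔ t = S (j + 1)) (t : ℕ → ℕ) :
    (loop a body).Rel (S 0) t ↔ t = S k := by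
  have step : ∀ j < k, ∀ t, (seq (basic a .dec) body).Rel (S j) t ↔ t = S (j + 1) := by
    intro j hj t
    have h0 : 0 < S j a := by rw [ha j hj.le]; omega
    simp only [rel_seq, rel_dec, h0, true_and, exists_eq_left, hb j hj]
  have main : ∀ i j, j + i = k → ((loop a body).Rel (S j) t ↔ t = S k) := by
    intro i
    induction i with
    | zero =>
      intro j hj
      obtain rfl : j = k := hj
      have h0 : S j a = 0 := by rw [ha j le_rfl]; omega
      constructor
      · rintro ⟨u, hu, h⟩
        rcases Relation.ReflTransGen.cases_head hu with rfl | ⟨c, ⟨d, hc, -⟩, -⟩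
        · exact (rel_zero.1 h).2
        · rw [rel_dec] at hc; omega
      · rintro rfl
        exact ⟨_, .refl, rel_zero.2 ⟨h0, rfl⟩⟩
    | succ i ih =>
      intro j hj
      rw [← ih (j + 1) (by omega)]
      constructor
      · rintro ⟨u, hu, h⟩
        rcases Relation.ReflTransGen.cases_head hu with rfl | ⟨c, hc, hu⟩
        · have := (rel_zero.1 h).1
          rw [ha j (by omega)] at this
          omega
        · rw [step j (by omega)] at hc
          subst hc
          exact ⟨u, hu, h⟩
      · rintro ⟨u, hu, h⟩
        exact ⟨u, hu.head ((step j (by omega) _).2 rfl), h⟩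
  exact main k 0 (by omega)

/-- Set a counter to `0`. -/
def clear (a : ℕ) : Prog := loop a (basic a .nop)

theorem rel_clear {a : ℕ} {s t : ℕ → ℕ} : (clear a).Rel s t ↔ t = update s a 0 := by
  have := loop_rel (a := a) (body := basic a .nop) (s a) (fun j => update s a (s a - j))
    (by simp) (fun j hj t => by
      rw [rel_nop]
      simp [Nat.sub_sub]) t
  simpa [clear] using this

/-- Add the counter `a` to the counter `b`, and reset `a`. -/
def move (a b : ℕ) : Prog := loop a (basic b .inc)

theorem rel_move {a b : ℕ} (hab : a ≠ b) {s t : ℕ → ℕ} :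
    (move a b).Rel s t ↔ t = update (update s a 0) b (s b + s a) := by
  have := loop_rel (a := a) (body := basic b .inc) (s a)
    (fun j => update (update s a (s a - j)) b (s b + j))
    (by simp [hab]) (fun j hj t => by
      rw [rel_inc]
      apply Eq.congr_right
      funext x
      simp only [update_apply]
      grind) t
  simpa [move] using this

/-- Add the counter `a` to the counter `b`, using the auxiliary counter `c`. -/
def copy (a b c : ℕ) : Prog := seq (loop a (seq (basic b .inc) (basic c .inc))) (move c a)

theorem rel_copy {a b c : ℕ} (hab : a ≠ b) (hac : a ≠ c) (hbc : b ≠ c) {s t : ℕ → ℕ}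
    (hc : s c = 0) : (copy a b c).Rel s t ↔ t = update s b (s b + s a) := by
  have := fun t => loop_rel (a := a) (body := seq (basic b .inc) (basic c .inc)) (s a)
    (fun j => update (update (update s a (s a - j)) b (s b + j)) c j)
    (by simp [hab, hac]) (fun j hj t => by
      simp only [rel_seq, rel_inc, exists_eq_left]
      apply Eq.congr_right
      funext x
      simp only [update_apply]
      grind) t
  simp only [tsub_zero, update_eq_self, add_zero] at this
  have hc' : update s c 0 = s := by rw [← hc, update_eq_self]
  rw [hc'] at this
  simp only [copy, rel_seq, this, exists_eq_left, rel_move hac.symm]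
  apply Eq.congr_right
  funext x
  simp only [update_apply]
  grind

/-- A strict upper bound for the counters that a program uses. -/
def bound : Prog → ℕ
  | basic r _ => r + 1
  | seq p q => max p.bound q.bound
  | star p => p.bound

end Prog

section Computes

open Function Prog

/-- A partial function is computed by counter programs if, for all input counters below `N`, some
program writes a value of the function into the counter `N`, provided that all counters from `N` on
are `0` initially; it has no other effect, and it has a complete run only if there is a value. -/
def Computes {n : ℕ} (f : List.Vector ℕ n →. ℕ) : Prop :=
  ∀ (v : Fin n → ℕ) (N : ℕ), (∀ i, v i < N) → ∃ p : Prog, ∀ s : ℕ → ℕ, (∀ j, N ≤ j → s j = 0) →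
    ∀ t, p.Rel s t ↔ ∃ y ∈ f (List.Vector.ofFn fun i => s (v i)), t = update s N y

theorem mem_mOfFn {n : ℕ} {g : Fin n → Part ℕ} {w : List.Vector ℕ n} :
    w ∈ List.Vector.mOfFn g ↔ ∀ i, w.get i ∈ g i := by
  induction n with
  | zero =>
    simp only [List.Vector.mOfFn, IsEmpty.forall_iff, iff_true]
    rw [List.Vector.eq_nil w]
    exact Part.mem_some _
  | succ n ih =>
    simp only [List.Vector.mOfFn, Part.bind_eq_bind, Part.mem_bind_iff, Fin.forall_fin_succ]
    constructor
    · rintro ⟨a, ha, u, hu, hw⟩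
      obtain rfl : w = a ::ᵥ u := Part.mem_some_iff.1 hw
      exact ⟨by simpa using ha, by simpa using ih.1 hu⟩
    · rintro ⟨h0, h1⟩
      refine ⟨_, h0, w.tail, ih.2 fun i => by simpa using h1 i, ?_⟩
      refine Part.mem_some_iff.2 ?_
      rw [List.Vector.get_zero, List.Vector.cons_head_tail]

theorem Computes.congr {n : ℕ} {f g : List.Vector ℕ n →. ℕ} (hf : Computes f)
    (h : ∀ v, f v = g v) : Computes g := by
  rwa [← show f = g from funext h]

theorem computes_succ : Computes (n := 1) fun v => Part.some (Nat.succ v.head) := by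
  intro v N hv
  refine ⟨seq (copy (v 0) N (N + 1)) (basic N .inc), fun s hs t => ?_⟩
  have h0 := hv 0
  simp only [rel_seq, rel_copy (show v 0 ≠ N by omega) (show v 0 ≠ N + 1 by omega)
    (show N ≠ N + 1 by omega) (hs (N + 1) (by omega)), exists_eq_left, rel_inc, Part.mem_some_iff]
  simp [hs N le_rfl]

theorem computes_get {n : ℕ} (i : Fin n) : Computes fun v => Part.some (v.get i) := by
  intro v N hv
  refine ⟨copy (v i) N (N + 1), fun s hs t => ?_⟩
  have h0 := hv i
  simp only [rel_copy (show v i ≠ N by omega) (show v i ≠ N + 1 by omega)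
    (show N ≠ N + 1 by omega) (hs (N + 1) (by omega)), exists_eq_left, Part.mem_some_iff]
  simp [hs N le_rfl]

theorem computes_zero : Computes (n := 0) fun _ => Part.some 0 := by
  intro v N hv
  refine ⟨basic N .nop, fun s hs t => ?_⟩
  simp only [rel_nop, Part.mem_some_iff, exists_eq_left]
  rw [← hs N le_rfl, update_eq_self]

/-- The contents `s`, with the values `y 0, …, y (k - 1)` written into the counters from `M` on. -/
def fill (s : ℕ → ℕ) (M k : ℕ) (y : ℕ → ℕ) : ℕ → ℕ :=
  fun j => if M ≤ j ∧ j < M + k then y (j - M) else s j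

/-- Functions computed one after the other, with values in consecutive counters. -/
theorem computes_tuple {m n : ℕ} {g : Fin n → List.Vector ℕ m →. ℕ} (hg : ∀ i, Computes (g i))
    (v : Fin m → ℕ) (N : ℕ) (hv : ∀ i, v i < N) (k : ℕ) (hk : k ≤ n) :
    ∃ p : Prog, ∀ s : ℕ → ℕ, (∀ j, N ≤ j → s j = 0) → ∀ t, p.Rel s t ↔
      ∃ y : ℕ → ℕ, (∀ i, ∀ h : i < k, y i ∈ g ⟨i, by omega⟩ (List.Vector.ofFn fun i => s (v i))) ∧
        t = fill s N k y := by
  induction k with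
  | zero =>
    refine ⟨basic N .nop, fun s _ t => ?_⟩
    have h0 : ∀ y, fill s N 0 y = s := fun y => by
      funext j
      exact if_neg (by omega)
    simp [rel_nop, h0]
  | succ k ih =>
    obtain ⟨p, hp⟩ := ih (by omega)
    obtain ⟨q, hq⟩ := hg ⟨k, by omega⟩ v (N + k) (fun i => (hv i).trans_le (by omega))
    refine ⟨seq p q, fun s hs t => ?_⟩
    have hq' : ∀ y, q.Rel (fill s N k y) t ↔ ∃ z ∈ g ⟨k, by omega⟩ (List.Vector.ofFn fun i =>
        s (v i)), t = update (fill s N k y) (N + k) z := by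
      intro y
      rw [hq _ (fun j hj => by rw [fill, if_neg (by omega), hs j (by omega)])]
      have : ∀ i, fill s N k y (v i) = s (v i) := fun i =>
        if_neg (by have := hv i; omega)
      simp only [this]
    simp only [rel_seq, hp s hs]
    constructor
    · rintro ⟨_, ⟨y, hy, rfl⟩, h⟩
      obtain ⟨z, hz, rfl⟩ := (hq' y).1 h
      refine ⟨update y k z, fun i hi => ?_, ?_⟩
      · by_cases h : i = k
        · subst h; simpa using hz
        · rw [update_of_ne h]; exact hy i (by omega)
      · funext j
        simp only [fill, update_apply]
        grind
    · rintro ⟨y, hy, rfl⟩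
      refine ⟨_, ⟨y, fun i hi => hy i (by omega), rfl⟩, (hq' y).2 ⟨y k, hy k (by omega), ?_⟩⟩
      funext j
      simp only [fill, update_apply]
      grind

theorem exists_clear_range (M k : ℕ) :
    ∃ p : Prog, ∀ s t, p.Rel s t ↔ t = fill s M k fun _ => 0 := by
  induction k with
  | zero =>
    refine ⟨basic M .nop, fun s t => ?_⟩
    have h0 : fill s M 0 (fun _ => 0) = s := by
      funext j
      exact if_neg (by omega)
    rw [h0, rel_nop]
  | succ k ih =>
    obtain ⟨p, hp⟩ := ih
    refine ⟨seq p (clear (M + k)), fun s t => ?_⟩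
    simp only [rel_seq, hp, exists_eq_left, rel_clear]
    apply Eq.congr_right
    funext j
    simp only [fill, update_apply]
    grind

theorem Computes.comp {m n : ℕ} {f : List.Vector ℕ n →. ℕ} (hf : Computes f)
    {g : Fin n → List.Vector ℕ m →. ℕ} (hg : ∀ i, Computes (g i)) :
    Computes fun v => (List.Vector.mOfFn fun i => g i v) >>= f := by
  intro v N hv
  obtain ⟨p, hp⟩ := computes_tuple hg v (N + 1) (fun i => (hv i).trans (by omega)) n le_rfl
  obtain ⟨q, hq⟩ := hf (fun i => N + 1 + i) (N + 1 + n) (fun i => by omega)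
  obtain ⟨c, hc⟩ := exists_clear_range (N + 1) n
  refine ⟨seq (seq p q) (seq c (move (N + 1 + n) N)), fun s hs t => ?_⟩
  have hs' : ∀ j, N + 1 ≤ j → s j = 0 := fun j hj => hs j (by omega)
  have hq' : ∀ y u, q.Rel (fill s (N + 1) n y) u ↔ ∃ z ∈ f (List.Vector.ofFn fun i : Fin n => y i),
      u = update (fill s (N + 1) n y) (N + 1 + n) z := by
    intro y u
    rw [hq _ (fun j hj => by rw [fill, if_neg (by omega), hs j (by omega)])]
    have : ∀ i : Fin n, fill s (N + 1) n y (N + 1 + i) = y i := fun i => by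
      rw [fill, if_pos (by omega)]
      congr 1
      omega
    simp only [this]
  have hr : ∀ y z, (seq c (move (N + 1 + n) N)).Rel
      (update (fill s (N + 1) n y) (N + 1 + n) z) t ↔ t = update s N z := by
    intro y z
    simp only [rel_seq, hc, exists_eq_left, rel_move (show N + 1 + n ≠ N by omega)]
    apply Eq.congr_right
    funext j
    have := hs N le_rfl
    have := hs' (N + 1 + n) (by omega)
    have := hs' j
    simp only [fill, update_apply]
    grind
  rw [rel_seq]
  simp only [rel_seq (p := p), hp s hs']
  have key : ∀ z, z ∈ (List.Vector.mOfFn (fun i => g i (List.Vector.ofFn fun i => s (v i))) >>= f) ↔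
      ∃ w : List.Vector ℕ n, (∀ i, w.get i ∈ g i (List.Vector.ofFn fun i => s (v i))) ∧ z ∈ f w :=
    fun z => Part.mem_bind_iff.trans (by simp only [mem_mOfFn])
  constructor
  · rintro ⟨u, ⟨_, ⟨y, hy, rfl⟩, h1⟩, h2⟩
    obtain ⟨z, hz, rfl⟩ := (hq' y u).1 h1
    exact ⟨z, (key z).2 ⟨_, fun i => by simpa using hy i i.2, hz⟩, (hr y z).1 h2⟩
  · rintro ⟨z, hz, rfl⟩
    obtain ⟨w, hw, hz⟩ := (key z).1 hz
    let y : ℕ → ℕ := fun i => if h : i < n then w.get ⟨i, h⟩ else 0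
    have hy : ∀ i : Fin n, y i = w.get i := fun i => by simp [y]
    have hyw : (List.Vector.ofFn fun i : Fin n => y i) = w := by
      apply List.Vector.ext
      intro i
      rw [List.Vector.get_ofFn, hy]
    refine ⟨_, ⟨_, ⟨y, fun i hi => ?_, rfl⟩, (hq' y _).2 ⟨z, by rwa [hyw], rfl⟩⟩, (hr y z).2 rfl⟩
    rw [hy ⟨i, hi⟩]
    exact hw ⟨i, hi⟩

/-- Primitive recursion: the counters `N`, `N + 1` and `N + 2` hold the current value, the number of
rounds done and the number of rounds left. -/
theorem Computes.prec {n : ℕ} {f : List.Vector ℕ n → ℕ} {g : List.Vector ℕ (n + 2) → ℕ}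
    (hf : Computes fun v => Part.some (f v)) (hg : Computes fun v => Part.some (g v)) :
    Computes fun v : List.Vector ℕ (n + 1) => Part.some
      (v.head.rec (f v.tail) fun y IH => g (y ::ᵥ IH ::ᵥ v.tail) : ℕ) := by
  intro v N hv
  obtain ⟨p, hp⟩ := hf (fun i => v i.succ) N (fun i => hv _)
  obtain ⟨q, hq⟩ := hg (Fin.cons (N + 1) (Fin.cons N fun i => v i.succ)) (N + 3) (by
    intro i
    refine Fin.cases (by simp) (fun i => Fin.cases (by simp) (fun i => ?_) i) i
    have := hv i.succ
    simp only [Fin.cons_succ]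
    omega)
  have h0 := hv 0
  refine ⟨seq (seq p (copy (v 0) (N + 2) (N + 3))) (seq (loop (N + 2)
    (seq q (seq (clear N) (seq (move (N + 3) N) (basic (N + 1) .inc))))) (clear (N + 1))),
    fun s hs t => ?_⟩
  set x : List.Vector ℕ n := List.Vector.ofFn fun i => s (v i.succ) with hx
  have hxx : (List.Vector.ofFn fun i => s (v i)) = s (v 0) ::ᵥ x := rfl
  let val : ℕ → ℕ := fun j => Nat.rec (f x) (fun y IH => g (y ::ᵥ IH ::ᵥ x)) j
  -- the contents after `j` rounds of the loop
  let S : ℕ → ℕ → ℕ := fun j =>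
    update (update (update s N (val j)) (N + 1) j) (N + 2) (s (v 0) - j)
  have hl := fun t => loop_rel (a := N + 2)
    (body := seq q (seq (clear N) (seq (move (N + 3) N) (basic (N + 1) .inc)))) (s (v 0)) S
    (by simp [S]) (fun j hj t => by
      rw [rel_seq]
      simp only [rel_seq, rel_clear, rel_move (show N + 3 ≠ N by omega), rel_inc, exists_eq_left]
      simp only [hq (update (S j) (N + 2) (S j (N + 2) - 1)) (by
        intro i hi
        simp only [S, update_apply]
        rw [if_neg (by omega), if_neg (by omega), if_neg (by omega), if_neg (by omega)]
        exact hs i (by omega)), Part.mem_some_iff, exists_eq_left]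
      have harg : (List.Vector.ofFn fun i => update (S j) (N + 2) (S j (N + 2) - 1)
          ((Fin.cons (N + 1) (Fin.cons N fun i => v i.succ) : Fin (n + 2) → ℕ) i)) =
          j ::ᵥ val j ::ᵥ x := by
        apply List.Vector.ext
        intro i
        rw [List.Vector.get_ofFn]
        refine Fin.cases (by simp [S]) (fun i => Fin.cases (by simp [S]; rfl)
          (fun i => ?_) i) i
        have := hv i.succ
        simp only [Fin.cons_succ, List.Vector.get_cons_succ, S, update_apply, hx,
          List.Vector.get_ofFn]
        rw [if_neg (by omega), if_neg (by omega), if_neg (by omega), if_neg (by omega)]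
      have hval : val (j + 1) = g (j ::ᵥ val j ::ᵥ x) := rfl
      rw [harg, ← hval]
      apply Eq.congr_right
      funext i
      have := hs (N + 3) (by omega)
      simp only [S, update_apply]
      grind) t
  have hS : update (update s N (val 0)) (N + 2)
      (update s N (val 0) (N + 2) + update s N (val 0) (v 0)) = S 0 := by
    funext i
    have := hs (N + 2) (by omega)
    have := hs (N + 1) (by omega)
    simp only [S, update_apply]
    grind
  rw [rel_seq]
  simp only [rel_seq (p := p), hp s hs, Part.mem_some_iff, exists_eq_left]
  rw [← hx]
  have h1 : ∀ t, (copy (v 0) (N + 2) (N + 3)).Rel (update s N (f x)) t ↔ t = S 0 := by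
    intro t
    rw [rel_copy (by omega) (by omega) (by omega)
      (by rw [update_of_ne (by omega)]; exact hs _ (by omega))]
    exact Eq.congr_right hS
  simp only [h1, exists_eq_left, rel_seq, hl, rel_clear, hxx]
  apply Eq.congr_right
  have hv0 : List.Vector.head (s (v 0) ::ᵥ x) = s (v 0) := rfl
  have hv1 : List.Vector.tail (s (v 0) ::ᵥ x) = x := rfl
  rw [hv0, hv1]
  change _ = update s N (val (s (v 0)))
  funext i
  have := hs (N + 2) (by omega)
  have := hs (N + 1) (by omega)
  simp only [S, update_apply]
  grind

/-- Unbounded search: the loop is left nondeterministically, and the decrement in its body and the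
final test for zero admit only the correct moment. -/
theorem Computes.rfind {n : ℕ} {f : List.Vector ℕ (n + 1) → ℕ}
    (hf : Computes fun v => Part.some (f v)) :
    Computes fun v => Nat.rfind fun k => Part.some (decide (f (k ::ᵥ v) = 0)) := by
  intro v N hv
  obtain ⟨q, hq⟩ := hf (Fin.cons N v) (N + 1) (by
    intro i
    refine Fin.cases (by simp) (fun i => ?_) i
    have := hv i
    simp only [Fin.cons_succ]
    omega)
  let body : Prog := seq q (seq (basic (N + 1) .dec) (seq (clear (N + 1)) (basic N .inc)))
  refine ⟨seq (star body) (seq q (basic (N + 1) .zero)), fun s hs t => ?_⟩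
  set x : List.Vector ℕ n := List.Vector.ofFn fun i => s (v i) with hx
  have hq' : ∀ j t, q.Rel (update s N j) t ↔ t = update (update s N j) (N + 1) (f (j ::ᵥ x)) := by
    intro j t
    rw [hq _ (fun i hi => by rw [update_of_ne (by omega)]; exact hs i (by omega))]
    simp only [Part.mem_some_iff, exists_eq_left]
    have harg : (List.Vector.ofFn fun i => update s N j ((Fin.cons N v : Fin (n + 1) → ℕ) i)) =
        j ::ᵥ x := by
      apply List.Vector.ext
      intro i
      rw [List.Vector.get_ofFn]
      refine Fin.cases (by simp) (fun i => ?_) i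
      have := hv i
      simp only [Fin.cons_succ, List.Vector.get_cons_succ, hx, List.Vector.get_ofFn]
      rw [update_of_ne (by omega)]
    rw [harg]
  have hbody : ∀ j t, body.Rel (update s N j) t ↔ 0 < f (j ::ᵥ x) ∧ t = update s N (j + 1) := by
    intro j t
    simp only [body, rel_seq, hq', exists_eq_left, rel_dec, rel_clear, rel_inc, update_self]
    have h1 : ∀ z, update (update (update (update s N j) (N + 1) (f (j ::ᵥ x))) (N + 1) z)
        (N + 1) 0 = update s N j := by
      intro z
      have := hs (N + 1) (by omega)
      funext i
      simp only [update_apply]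
      grind
    simp only [and_assoc, exists_and_left, exists_eq_left, h1]
    simp
  have hstar : ∀ u, (star body).Rel (update s N 0) u ↔
      ∃ j, (∀ i < j, 0 < f (i ::ᵥ x)) ∧ u = update s N j := by
    intro u
    constructor
    · intro h
      change Relation.ReflTransGen body.Rel _ _ at h
      induction h with
      | refl => exact ⟨0, by simp, rfl⟩
      | tail _ h ih =>
        obtain ⟨j, hj, rfl⟩ := ih
        obtain ⟨h1, rfl⟩ := (hbody j _).1 h
        refine ⟨j + 1, fun i hi => ?_, rfl⟩
        rcases Nat.lt_succ_iff_lt_or_eq.1 hi with h | rfl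
        · exact hj i h
        · exact h1
    · rintro ⟨j, hj, rfl⟩
      change Relation.ReflTransGen body.Rel _ _
      induction j with
      | zero => exact .refl
      | succ j ih =>
        exact (ih fun i hi => hj i (by omega)).tail ((hbody j _).2 ⟨hj j (by omega), rfl⟩)
  have hs0 : update s N 0 = s := by rw [← hs N le_rfl, update_eq_self]
  rw [hs0] at hstar
  simp only [rel_seq, hstar]
  have key : ∀ y, y ∈ Nat.rfind (fun k => Part.some (decide (f (k ::ᵥ x) = 0)) : ℕ →. Bool) ↔
      f (y ::ᵥ x) = 0 ∧ ∀ i < y, f (i ::ᵥ x) ≠ 0 := by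
    intro y
    refine Nat.mem_rfind.trans ?_
    simp only [Part.mem_some_iff, true_eq_decide_iff, false_eq_decide_iff]
  constructor
  · rintro ⟨_, ⟨j, hj, rfl⟩, u, hu, h⟩
    rw [hq'] at hu
    subst hu
    obtain ⟨h1, rfl⟩ := rel_zero.1 h
    rw [update_self] at h1
    refine ⟨j, (key j).2 ⟨h1, fun i hm => (hj _ hm).ne'⟩, ?_⟩
    rw [h1, ← hs (N + 1) (by omega)]
    exact update_eq_self_iff.2 (by simp)
  · rintro ⟨j, hj, rfl⟩
    obtain ⟨h1, hj⟩ := (key j).1 hj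
    refine ⟨_, ⟨j, fun i hi => Nat.pos_of_ne_zero (hj i hi), rfl⟩, _, (hq' j _).2 rfl, ?_⟩
    rw [rel_zero]
    refine ⟨by simpa using h1, ?_⟩
    rw [h1, ← hs (N + 1) (by omega)]
    exact (update_eq_self_iff.2 (by simp)).symm

theorem computes_of_primrec {n : ℕ} {f : List.Vector ℕ n → ℕ} (hf : Nat.Primrec' f) :
    Computes fun v => Part.some (f v) := by
  induction hf with
  | zero => exact computes_zero
  | succ => exact computes_succ
  | get i => exact computes_get i
  | comp g _ _ ihf ihg =>
    refine (ihf.comp ihg).congr fun v => ?_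
    rw [Vector.mOfFn_part_some]
    simp
  | prec _ _ ihf ihg => exact ihf.prec ihg

/-- Counter programs compute all partial recursive functions. -/
theorem computes_of_partrec {n : ℕ} {f : List.Vector ℕ n →. ℕ} (hf : Nat.Partrec' f) :
    Computes f := by
  induction hf with
  | prim h => exact computes_of_primrec h
  | comp g _ _ ihf ihg => exact ihf.comp ihg
  | rfind _ ih => exact ih.rfind

end Computes

/-! ### Control graphs of counter programs -/

namespace Prog

/-- The nodes of the control graph. -/
def Loc : Prog → Type
  | basic _ _ => Bool
  | seq p q => p.Loc ⊕ q.Loc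
  | star p => Option p.Loc

/-- The node at which the program is entered. -/
def entry : (p : Prog) → p.Loc
  | basic _ _ => false
  | seq p _ => .inl p.entry
  | star _ => none

/-- The node at which the program is left. -/
def exit : (p : Prog) → p.Loc
  | basic _ _ => true
  | seq _ q => .inr q.exit
  | star _ => none

/-- The edges of the control graph, labelled with an instruction. -/
def Edge : (p : Prog) → p.Loc → ℕ × Op → p.Loc → Prop
  | basic r o, x, a, y => x = false ∧ a = (r, o) ∧ y = true
  | seq p _, .inl x, a, .inl y => p.Edge x a y
  | seq p q, .inl x, a, .inr y => x = p.exit ∧ a = (0, .nop) ∧ y = q.entry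
  | seq _ _, .inr _, _, .inl _ => False
  | seq _ q, .inr x, a, .inr y => q.Edge x a y
  | star _, none, _, none => False
  | star p, none, a, some y => a = (0, .nop) ∧ y = p.entry
  | star p, some x, a, none => x = p.exit ∧ a = (0, .nop)
  | star p, some x, a, some y => p.Edge x a y

theorem finite_loc (p : Prog) : Finite p.Loc := by
  induction p with
  | basic => exact inferInstanceAs (Finite Bool)
  | seq p q ihp ihq => exact inferInstanceAs (Finite (p.Loc ⊕ q.Loc))
  | star p ih => exact inferInstanceAs (Finite (Option p.Loc))

theorem bound_pos (p : Prog) : 0 < p.bound := by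
  induction p with
  | basic => exact Nat.succ_pos _
  | seq p q ihp ihq => exact lt_max_of_lt_left ihp
  | star p ih => exact ih

theorem Edge.lt_bound {p : Prog} {x y : p.Loc} {a : ℕ × Op} (h : p.Edge x a y) : a.1 < p.bound := by
  induction p with
  | basic r o =>
    rw [h.2.1]
    exact Nat.lt_succ_self r
  | seq p q ihp ihq =>
    rcases x with x | x <;> rcases y with y | y
    · exact lt_max_of_lt_left (ihp h)
    · rw [h.2.1]
      exact bound_pos _
    · exact h.elim
    · exact lt_max_of_lt_right (ihq h)
  | star p ih =>
    rcases x with _ | x <;> rcases y with _ | y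
    · exact h.elim
    · rw [h.1]
      exact bound_pos p
    · rw [h.2]
      exact bound_pos p
    · exact ih h

/-- One step in the control graph. -/
def Step (p : Prog) (c d : p.Loc × (ℕ → ℕ)) : Prop :=
  ∃ r o, p.Edge c.1 (r, o) d.1 ∧ (basic r o).Rel c.2 d.2

/-- Reachability in the control graph. -/
def Reach (p : Prog) : p.Loc × (ℕ → ℕ) → p.Loc × (ℕ → ℕ) → Prop := Relation.ReflTransGen p.Step

theorem reach_seq_left {p q : Prog} {c d : p.Loc × (ℕ → ℕ)} (h : p.Reach c d) :
    (seq p q).Reach (.inl c.1, c.2) (.inl d.1, d.2) :=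
  Relation.ReflTransGen.lift (r := p.Step) (p := (seq p q).Step)
    (fun c : p.Loc × (ℕ → ℕ) => ((Sum.inl c.1 : (seq p q).Loc), c.2)) (fun _ _ h => h) _ _ h

theorem reach_seq_right {p q : Prog} {c d : q.Loc × (ℕ → ℕ)} (h : q.Reach c d) :
    (seq p q).Reach (.inr c.1, c.2) (.inr d.1, d.2) :=
  Relation.ReflTransGen.lift (r := q.Step) (p := (seq p q).Step)
    (fun c : q.Loc × (ℕ → ℕ) => ((Sum.inr c.1 : (seq p q).Loc), c.2)) (fun _ _ h => h) _ _ h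

theorem reach_star_body {p : Prog} {c d : p.Loc × (ℕ → ℕ)} (h : p.Reach c d) :
    (star p).Reach (some c.1, c.2) (some d.1, d.2) :=
  Relation.ReflTransGen.lift (r := p.Step) (p := (star p).Step)
    (fun c : p.Loc × (ℕ → ℕ) => ((some c.1 : (star p).Loc), c.2)) (fun _ _ h => h) _ _ h

/-- A path from the entry of `p` is still in `p`, or has completed `p` and gone on to `q`. -/
theorem reach_seq_cases {p q : Prog} {s : ℕ → ℕ} {d : (seq p q).Loc × (ℕ → ℕ)}
    (h : (seq p q).Reach (.inl p.entry, s) d) :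
    match d with
    | (.inl x, t) => p.Reach (p.entry, s) (x, t)
    | (.inr y, t) => ∃ u, p.Reach (p.entry, s) (p.exit, u) ∧ q.Reach (q.entry, u) (y, t) := by
  change Relation.ReflTransGen _ _ _ at h
  induction h with
  | refl => exact Relation.ReflTransGen.refl
  | @tail c d _ h ih =>
    obtain ⟨r, o, he, hr⟩ := h
    rcases c with ⟨x | x, u⟩ <;> rcases d with ⟨y | y, t⟩
    · exact Relation.ReflTransGen.tail ih ⟨r, o, he, hr⟩
    · obtain ⟨rfl, ha, rfl⟩ := he
      obtain ⟨rfl, rfl⟩ := Prod.mk.inj ha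
      rw [rel_nop] at hr
      obtain rfl : t = u := hr
      exact ⟨t, ih, .refl⟩
    · exact he.elim
    · obtain ⟨w, h1, h2⟩ := ih
      exact ⟨w, h1, h2.tail ⟨r, o, he, hr⟩⟩

/-- A path through the graph of `star p` consists of complete passages through `p` and possibly an
incomplete one. -/
theorem reach_star_cases {p : Prog} {s : ℕ → ℕ} {d : (star p).Loc × (ℕ → ℕ)}
    (h : (star p).Reach (none, s) d) :
    match d with
    | (none, t) => Relation.ReflTransGen (fun s t => p.Reach (p.entry, s) (p.exit, t)) s t
    | (some y, t) => ∃ u, Relation.ReflTransGen (fun s t => p.Reach (p.entry, s) (p.exit, t)) s u ∧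
        p.Reach (p.entry, u) (y, t) := by
  change Relation.ReflTransGen _ _ _ at h
  induction h with
  | refl => exact Relation.ReflTransGen.refl
  | @tail c d _ h ih =>
    obtain ⟨r, o, he, hr⟩ := h
    rcases c with ⟨_ | x, u⟩ <;> rcases d with ⟨_ | y, t⟩
    · exact he.elim
    · obtain ⟨ha, rfl⟩ := he
      obtain ⟨rfl, rfl⟩ := Prod.mk.inj ha
      rw [rel_nop] at hr
      obtain rfl : t = u := hr
      exact ⟨t, ih, .refl⟩
    · obtain ⟨rfl, ha⟩ := he
      obtain ⟨rfl, rfl⟩ := Prod.mk.inj ha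
      rw [rel_nop] at hr
      obtain rfl : t = u := hr
      obtain ⟨w, h1, h2⟩ := ih
      exact h1.tail h2
    · obtain ⟨w, h1, h2⟩ := ih
      exact ⟨w, h1, h2.tail ⟨r, o, he, hr⟩⟩

/-- The paths through the control graph realize the relation of the program. -/
theorem reach_iff (p : Prog) (s t : ℕ → ℕ) : p.Reach (p.entry, s) (p.exit, t) ↔ p.Rel s t := by
  induction p generalizing s t with
  | basic r o =>
    constructor
    · intro h
      rcases Relation.ReflTransGen.cases_head h with h | ⟨c, ⟨r', o', ⟨_, ha, hc⟩, hr⟩, h⟩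
      · exact absurd (congrArg Prod.fst h) Bool.false_ne_true
      · obtain ⟨rfl, rfl⟩ := Prod.mk.inj ha
        rcases Relation.ReflTransGen.cases_head h with rfl | ⟨d, ⟨_, _, ⟨hf, _⟩, _⟩, _⟩
        · exact hr
        · exact absurd (hc.symm.trans hf).symm Bool.false_ne_true
    · intro h
      exact Relation.ReflTransGen.single ⟨r, o, ⟨rfl, rfl, rfl⟩, h⟩
  | seq p q ihp ihq =>
    constructor
    · intro h
      obtain ⟨u, h1, h2⟩ := reach_seq_cases h
      exact ⟨u, (ihp _ _).1 h1, (ihq _ _).1 h2⟩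
    · rintro ⟨u, h1, h2⟩
      refine (reach_seq_left ((ihp _ _).2 h1)).trans (Relation.ReflTransGen.head ?_
        (reach_seq_right ((ihq _ _).2 h2)))
      exact ⟨0, .nop, ⟨rfl, rfl, rfl⟩, rel_nop.2 rfl⟩
  | star p ih =>
    constructor
    · intro h
      exact Relation.ReflTransGen.mono (fun s t h => (ih s t).1 h) _ _ (reach_star_cases h)
    · intro h
      change Relation.ReflTransGen _ _ _ at h
      induction h with
      | refl => exact .refl
      | @tail u v _ h ih' =>
        refine Relation.ReflTransGen.trans ih' (Relation.ReflTransGen.head (b := (some p.entry, u))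
          ⟨0, .nop, ⟨rfl, rfl⟩, rel_nop.2 rfl⟩ (Relation.ReflTransGen.tail
          (reach_star_body ((ih _ _).2 h)) ⟨0, .nop, ⟨rfl, rfl⟩, rel_nop.2 rfl⟩))

end Prog

/-! ### Queue machines -/

/-- A finite graph that works on a queue of `K` counters: every node takes the counter that was
written `K` nodes ago, and appends the result of its operation to the queue. The operation of a node
is `op`; `reg` is its position modulo `K`, so that the nodes with the same value of `reg` work on
the same counter. The nodes satisfying `Mark` are counted, and `Acc` are the accepting nodes. -/
structure QueueMachine (K : ℕ) where
  Node : Type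
  start : Node
  Succ : Node → Node → Prop
  reg : Node → ℕ
  op : Node → Op
  Mark : Node → Prop
  Acc : Node → Prop
  reg_start : reg start = 0
  reg_succ : ∀ {x y}, Succ x y → reg y = (reg x + 1) % K

namespace QueueMachine

variable {K : ℕ}

/-- The nodes `ν 0, …, ν a` form a path from the start node. -/
def IsPath (M : QueueMachine K) (ν : ℕ → M.Node) (a : ℕ) : Prop :=
  ν 0 = M.start ∧ ∀ g < a, M.Succ (ν g) (ν (g + 1))

theorem IsPath.reg_eq {M : QueueMachine K} {ν : ℕ → M.Node} {a : ℕ} (h : M.IsPath ν a) {g : ℕ}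
    (hg : g ≤ a) : M.reg (ν g) = g % K := by
  induction g with
  | zero => rw [h.1, M.reg_start, Nat.zero_mod]
  | succ g ih => rw [M.reg_succ (h.2 g (by omega)), ih (by omega), Nat.mod_add_mod]

/-- The first `K` nodes of every path test a counter for `0`. -/
def StartsWithZeroTests (M : QueueMachine K) : Prop :=
  ∀ ν a, M.IsPath ν a → ∀ g ≤ a, g < K → M.op (ν g) = .zero

open Classical in
/-- Some path from the start node to an accepting one, with exactly `n` marked nodes before its last
node, can be executed, the first `K` counters in the queue being `0`. -/
def Accepts (M : QueueMachine K) (n : ℕ) : Prop :=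
  ∃ (ν : ℕ → M.Node) (c : ℕ → ℕ) (a : ℕ), M.IsPath ν a ∧ M.Acc (ν a) ∧
    Nat.count (fun g => M.Mark (ν g)) a = n ∧ (∀ g ≤ a, g < K → c g = 0) ∧
    ∀ g ≤ a, K ≤ g → (M.op (ν g)).Rel (c (g - K)) (c g)

end QueueMachine

theorem count_congr {P Q : ℕ → Prop} [DecidablePred P] [DecidablePred Q] {n : ℕ}
    (h : ∀ m < n, P m ↔ Q m) : Nat.count P n = Nat.count Q n :=
  le_antisymm (Nat.count_mono_left fun m hm => (h m hm).1)
    (Nat.count_mono_left fun m hm => (h m hm).2)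

/-- If only the last of every `k + 1` consecutive numbers may be marked, then counting the marked
numbers amounts to counting the blocks. -/
theorem count_blocks {k : ℕ} (P Q : ℕ → Prop) [DecidablePred P] [DecidablePred Q] (b j : ℕ)
    (hj : j ≤ k) (hQ : ∀ g < (k + 1) * b + j, Q g ↔ g % (k + 1) = k ∧ P (g / (k + 1))) :
    Nat.count Q ((k + 1) * b + j) = Nat.count P b := by
  have h0 : ∀ b j, j ≤ k → (∀ g < (k + 1) * b + j, Q g ↔ g % (k + 1) = k ∧ P (g / (k + 1))) →
      Nat.count Q ((k + 1) * b + j) = Nat.count Q ((k + 1) * b) := by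
    intro b j hj hQ
    rw [Nat.count_add]
    convert Nat.add_zero _
    rw [Nat.count_iff_forall_not]
    intro i hi h
    have := ((hQ _ (by omega)).1 h).1
    rw [Nat.mul_add_mod, Nat.mod_eq_of_lt (by omega)] at this
    omega
  rw [h0 b j hj hQ]
  clear hj
  induction b generalizing j with
  | zero => simp
  | succ b ih =>
    have e : (k + 1) * (b + 1) = ((k + 1) * b + k) + 1 := by ring
    have hQ' : ∀ g < (k + 1) * b + k, Q g ↔ g % (k + 1) = k ∧ P (g / (k + 1)) :=
      fun g hg => hQ g (by omega)
    rw [e, Nat.count_succ, Nat.count_succ, h0 b k le_rfl hQ', ih k hQ']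
    congr 1
    have := hQ ((k + 1) * b + k) (by omega)
    rw [Nat.mul_add_mod, Nat.mod_eq_of_lt (by omega), Nat.mul_add_div (by omega),
      Nat.div_eq_of_lt (by omega), Nat.add_zero] at this
    simp [this]

namespace Prog

/-- The control graph of a program, with a new node `none` in front of the entry: in that node, the
input counter `0` may be increased any number of times. -/
inductive FrontEdge (p : Prog) : Option p.Loc → ℕ × Op → Option p.Loc → Prop
  | input : FrontEdge p none (0, .inc) none
  | enter : FrontEdge p none (0, .nop) (some p.entry)
  | inner {x y : p.Loc} {a : ℕ × Op} (h : p.Edge x a y) : FrontEdge p (some x) a (some y)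

/-- The transitions of the machine for a program: `none` is the initial one, testing all counters
for `0` and leading to the front node. -/
def Trans (p : Prog) : Type :=
  Option {e : Option p.Loc × (Fin (p.bound + 1) × Op) × Option p.Loc //
    p.FrontEdge e.1 ((e.2.1.1 : ℕ), e.2.1.2) e.2.2}

namespace Trans

variable {p : Prog}

/-- The source of a transition; the initial one has none. -/
def src : p.Trans → Option (Option p.Loc)
  | none => none
  | some e => some e.1.1

/-- The target of a transition. -/
def tgt : p.Trans → Option p.Loc
  | none => none
  | some e => e.1.2.2

/-- The operation that a transition performs on the `r`-th counter. -/
def op : p.Trans → ℕ → Op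
  | none, _ => .zero
  | some e, r => if r = e.1.2.1.1 then e.1.2.1.2 else .nop

theorem finite : Finite p.Trans := by
  have := p.finite_loc
  exact inferInstanceAs (Finite (Option _))

/-- The operations of a transition, together, execute the instruction of an edge. -/
theorem exists_edge {t : p.Trans} {x : Option p.Loc} (h : t.src = some x) {s s' : ℕ → ℕ}
    (hs : ∀ r ≤ p.bound, (t.op r).Rel (s r) (s' r)) (h0 : ∀ r, p.bound < r → s' r = s r) :
    ∃ r o, p.FrontEdge x (r, o) t.tgt ∧ (basic r o).Rel s s' := by
  rcases t with _ | ⟨⟨x', ⟨r, o⟩, y⟩, he⟩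
  · simp [src] at h
  · obtain rfl : x' = x := by simpa [src] using h
    refine ⟨r, o, he, ?_, fun r' hr' => ?_⟩
    · simpa [op] using hs r (by omega)
    · rcases le_or_gt r' p.bound with h | h
      · simpa [op, hr', Op.Rel] using hs r' h
      · exact h0 r' h

/-- Every edge is executed by the operations of some transition. -/
theorem exists_of_edge {x y : Option p.Loc} {r : ℕ} {o : Op} (h : p.FrontEdge x (r, o) y) :
    ∃ t : p.Trans, t.src = some x ∧ t.tgt = y ∧
      ∀ s s' : ℕ → ℕ, (basic r o).Rel s s' → ∀ r, (t.op r).Rel (s r) (s' r) := by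
  have hr : r < p.bound + 1 := by
    cases h with
    | input => exact Nat.succ_pos _
    | enter => exact Nat.succ_pos _
    | inner h => exact h.lt_bound.trans (Nat.lt_succ_self _)
  refine ⟨some ⟨(x, (⟨r, hr⟩, o), y), h⟩, rfl, rfl, fun s s' hs r' => ?_⟩
  by_cases e : r' = r
  · subst e
    simpa [op] using hs.1
  · simpa [op, e, Op.Rel] using hs.2 r' e

end Trans

/-- The queue machine that runs a program: a transition becomes `p.bound + 1` consecutive nodes, one
for each counter. Arrivals at the front node are marked, arrivals at the exit are accepting. -/
def machine (p : Prog) : QueueMachine (p.bound + 1) where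
  Node := p.Trans × Fin (p.bound + 1)
  start := (none, 0)
  Succ x y := (y.2 : ℕ) = (x.2 + 1) % (p.bound + 1) ∧
    if (y.2 : ℕ) = 0 then y.1.src = some x.1.tgt else y.1 = x.1
  reg x := x.2
  op x := x.1.op x.2
  Mark x := x.2 = p.bound ∧ x.1.tgt = none
  Acc x := x.2 = p.bound ∧ x.1.tgt = some p.exit
  reg_start := rfl
  reg_succ h := h.1

theorem finite_machine_node (p : Prog) : Finite p.machine.Node := by
  have := Trans.finite (p := p)
  exact inferInstanceAs (Finite (p.Trans × Fin (p.bound + 1)))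

/-- The transition of a node does not change within a block. -/
theorem machine_path_fst {p : Prog} {ν : ℕ → p.machine.Node} {a : ℕ} (h : p.machine.IsPath ν a)
    {g : ℕ} (hg : g ≤ a) : (ν g).1 = (ν ((p.bound + 1) * (g / (p.bound + 1)))).1 := by
  induction g with
  | zero => simp
  | succ g ih =>
    have h1 : ((ν (g + 1)).2 : ℕ) = (g + 1) % (p.bound + 1) := h.reg_eq hg
    have h2 := (h.2 g (by omega)).2
    by_cases h0 : (g + 1) % (p.bound + 1) = 0
    · rw [Nat.mul_div_cancel' (Nat.dvd_of_mod_eq_zero h0)]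
    · rw [if_neg (by rwa [h1])] at h2
      rw [h2, ih (by omega), Nat.succ_div_of_mod_ne_zero h0]

theorem machine_startsWithZeroTests (p : Prog) : p.machine.StartsWithZeroTests := by
  intro ν a h g hg hK
  change (ν g).1.op _ = _
  rw [machine_path_fst h hg, Nat.div_eq_of_lt hK, Nat.mul_zero, h.1]
  rfl

open Classical in
/-- Some sequence of transitions, starting with the initial one and with all counters `0`, leads to
the node `q` with counter contents `s`, and arrives at the front node `n` times. -/
def Chain (p : Prog) (q : Option p.Loc) (s : ℕ → ℕ) (n : ℕ) : Prop :=
  ∃ (B : ℕ) (tr : ℕ → p.Trans) (st : ℕ → ℕ → ℕ), tr 0 = none ∧ st 0 = (fun _ => 0) ∧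
    (∀ b < B, (tr (b + 1)).src = some (tr b).tgt ∧
      ∀ r, ((tr (b + 1)).op r).Rel (st b r) (st (b + 1) r)) ∧
    Nat.count (fun b => (tr b).tgt = none) (B + 1) = n ∧ (tr B).tgt = q ∧ st B = s

open Classical in
theorem Chain.step {p : Prog} {q q' : Option p.Loc} {s s' : ℕ → ℕ} {n r : ℕ} {o : Op}
    (h : Chain p q s n) (he : p.FrontEdge q (r, o) q') (hs : (basic r o).Rel s s') :
    Chain p q' s' (n + if q' = none then 1 else 0) := by
  obtain ⟨B, tr, st, h0, h1, h2, h3, rfl, rfl⟩ := h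
  obtain ⟨t, ht, rfl, hop⟩ := Trans.exists_of_edge he
  refine ⟨B + 1, Function.update tr (B + 1) t, Function.update st (B + 1) s', ?_, ?_, ?_, ?_,
    by simp, by simp⟩
  · rw [Function.update_of_ne (by omega), h0]
  · rw [Function.update_of_ne (by omega), h1]
  · intro b hb
    rw [Function.update_of_ne (a := b) (by omega), Function.update_of_ne (a := b) (by omega)]
    rcases Nat.lt_succ_iff_lt_or_eq.1 hb with hb | rfl
    · rw [Function.update_of_ne (by omega), Function.update_of_ne (by omega)]
      exact h2 b hb
    · rw [Function.update_self, Function.update_self]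
      exact ⟨ht, hop _ _ hs⟩
  · rw [Nat.count_succ, Function.update_self, ← h3]
    congr 1
    exact count_congr fun m hm => by rw [Function.update_of_ne (by omega)]

theorem Chain.reach {p : Prog} {c d : p.Loc × (ℕ → ℕ)} {n : ℕ} (h : Chain p (some c.1) c.2 n)
    (hr : p.Reach c d) : Chain p (some d.1) d.2 n := by
  change Relation.ReflTransGen _ _ _ at hr
  induction hr with
  | refl => exact h
  | tail _ hs ih =>
    obtain ⟨r, o, he, hs⟩ := hs
    simpa using ih.step (.inner he) hs

/-- The initial transition and `n` increments in the front node. -/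
theorem chain_front (p : Prog) (n : ℕ) :
    Chain p none (Function.update (fun _ => 0) 0 n) (n + 1) := by
  induction n with
  | zero =>
    refine ⟨0, fun _ => none, fun _ _ => 0, rfl, rfl, fun _ h => absurd h (Nat.not_lt_zero _), ?_,
      rfl, (Function.update_eq_self _ _).symm⟩
    simp [Trans.tgt]
  | succ n ih =>
    have := ih.step .input (rel_inc.2 rfl)
    simpa using this

theorem machine_accepts_of_rel {p : Prog} {n : ℕ} {t : ℕ → ℕ}
    (h : p.Rel (Function.update (fun _ => 0) 0 n) t) : p.machine.Accepts (n + 1) := by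
  have h1 := (chain_front p n).step .enter (rel_nop.2 rfl)
  obtain ⟨B, tr, st, h0, hs0, hstep, hcount, htgt, -⟩ :=
    Chain.reach (c := (p.entry, _)) (by simpa using h1) ((reach_iff p _ _).2 h)
  have hmod : ∀ b j, j < (p.bound + 1) → ((p.bound + 1) * b + j) % (p.bound + 1) = j := by
    intro b j hj
    rw [Nat.mul_add_mod, Nat.mod_eq_of_lt hj]
  have hdiv : ∀ b j, j < (p.bound + 1) → ((p.bound + 1) * b + j) / (p.bound + 1) = b := by
    intro b j hj
    rw [Nat.mul_add_div (by omega), Nat.div_eq_of_lt hj, Nat.add_zero]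
  refine ⟨fun g => (tr (g / (p.bound + 1)), ⟨g % (p.bound + 1), Nat.mod_lt _ (by omega)⟩),
    fun g => st (g / (p.bound + 1)) (g % (p.bound + 1)),
    (p.bound + 1) * B + p.bound, ⟨?_, fun g hg => ⟨?_, ?_⟩⟩, ⟨?_, ?_⟩, ?_, fun g hg hgK => ?_,
    fun g hg hgK => ?_⟩
  · simp only [Nat.zero_div, Nat.zero_mod, h0]
    rfl
  · exact (Nat.mod_add_mod _ _ _).symm
  · dsimp only
    split_ifs with hz
    · have hd : (g + 1) / (p.bound + 1) = g / (p.bound + 1) + 1 :=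
        Nat.succ_div_of_dvd (Nat.dvd_of_mod_eq_zero hz)
      rw [hd]
      refine (hstep _ ?_).1
      have h2 : (g + 1) / (p.bound + 1) ≤ ((p.bound + 1) * B + p.bound) / (p.bound + 1) :=
        Nat.div_le_div_right hg
      rw [hdiv _ _ (by omega)] at h2
      omega
    · rw [Nat.succ_div_of_mod_ne_zero hz]
  · exact hmod _ _ (by omega)
  · dsimp only
    rw [hdiv _ _ (by omega), htgt]
  · have e : Nat.count (fun b => (tr b).tgt = none) B = n + 1 := by
      simp only [Nat.count_succ, htgt] at hcount
      simpa using hcount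
    classical
    rw [← e]
    refine Eq.trans (count_congr (Q := fun g => g % (p.bound + 1) = p.bound ∧
      (tr (g / (p.bound + 1))).tgt = none) ?_)
      (count_blocks (fun b => (tr b).tgt = none) _ B p.bound le_rfl fun g _ => Iff.rfl)
    exact fun g _ => Iff.rfl
  · dsimp only
    rw [Nat.div_eq_of_lt hgK, hs0]
  · have hd : g / (p.bound + 1) = (g - (p.bound + 1)) / (p.bound + 1) + 1 := by
      rw [← Nat.add_div_right _ (by omega), Nat.sub_add_cancel hgK]
    have hm : g % (p.bound + 1) = (g - (p.bound + 1)) % (p.bound + 1) := Nat.mod_eq_sub_mod hgK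
    change ((tr (g / (p.bound + 1))).op (g % (p.bound + 1))).Rel _ _
    dsimp only
    rw [hd, hm]
    refine (hstep _ ?_).2 _
    have h2 : g / (p.bound + 1) ≤ ((p.bound + 1) * B + p.bound) / (p.bound + 1) :=
      Nat.div_le_div_right hg
    rw [hdiv _ _ (by omega)] at h2
    omega

theorem rel_of_machine_accepts {p : Prog} {n : ℕ} (h : p.machine.Accepts (n + 1)) :
    ∃ t, p.Rel (Function.update (fun _ => 0) 0 n) t := by
  classical
  obtain ⟨ν, c, a, hν, hacc, hcount, hc0, hc⟩ := h
  have hmod : ∀ b j, j < (p.bound + 1) → ((p.bound + 1) * b + j) % (p.bound + 1) = j := by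
    intro b j hj
    rw [Nat.mul_add_mod, Nat.mod_eq_of_lt hj]
  have hdiv : ∀ b j, j < (p.bound + 1) → ((p.bound + 1) * b + j) / (p.bound + 1) = b := by
    intro b j hj
    rw [Nat.mul_add_div (by omega), Nat.div_eq_of_lt hj, Nat.add_zero]
  have hreg : ∀ g ≤ a, ((ν g).2 : ℕ) = g % (p.bound + 1) := fun g hg => hν.reg_eq hg
  have ha : a = (p.bound + 1) * (a / (p.bound + 1)) + p.bound := by
    have h1 := Nat.div_add_mod a (p.bound + 1)
    have h2 : ((ν a).2 : ℕ) = p.bound := hacc.1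
    have h3 := hreg a le_rfl
    omega
  set B := a / (p.bound + 1) with hB
  let tr : ℕ → p.Trans := fun b => (ν ((p.bound + 1) * b)).1
  let st : ℕ → ℕ → ℕ := fun b r => if r < (p.bound + 1) then c ((p.bound + 1) * b + r) else 0
  have hKB : ∀ {b}, b ≤ B → (p.bound + 1) * b ≤ (p.bound + 1) * B := fun h =>
    Nat.mul_le_mul_left _ h
  have htr : ∀ b ≤ B, ∀ r < (p.bound + 1), (ν ((p.bound + 1) * b + r)).1 = tr b := by
    intro b hb r hr
    have := hKB hb
    rw [machine_path_fst hν (by omega), hdiv b r hr]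
  have hs0 : st 0 = Function.update (fun _ => 0) 0 0 := by
    funext r
    simp only [st, Function.update_apply, Nat.mul_zero, Nat.zero_add]
    split_ifs with h1 <;> first | rfl | exact hc0 r (by omega) h1
  have hstep : ∀ b < B, ∃ r o, p.FrontEdge (tr b).tgt (r, o) (tr (b + 1)).tgt ∧
      (basic r o).Rel (st b) (st (b + 1)) := by
    intro b hb
    have h1 := hKB (b := b + 1) hb
    have e : (p.bound + 1) * (b + 1) = (p.bound + 1) * b + p.bound + 1 := by ring
    refine Trans.exists_edge ?_ (fun r hr => ?_) fun r hr => ?_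
    · have h2 := (hν.2 ((p.bound + 1) * b + p.bound) (by omega)).2
      rw [← e] at h2
      rw [if_pos (by rw [hreg _ (by omega), Nat.mul_mod_right])] at h2
      rw [htr b hb.le _ (by omega)] at h2
      exact h2
    · have h2 : ((ν ((p.bound + 1) * (b + 1) + r)).1.op
          (ν ((p.bound + 1) * (b + 1) + r)).2).Rel _ _ :=
        hc ((p.bound + 1) * (b + 1) + r) (by omega) (by omega)
      rw [htr (b + 1) hb _ (by omega), hreg _ (by omega), hmod _ _ (by omega)] at h2
      have h3 : (p.bound + 1) * (b + 1) + r - (p.bound + 1) = (p.bound + 1) * b + r := by omega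
      rw [h3] at h2
      simpa only [st, if_pos (show r < (p.bound + 1) by omega)] using h2
    · simp only [st, if_neg (show ¬ r < (p.bound + 1) by omega)]
  have ht0 : (tr 0).tgt = none := by
    have : ν 0 = (none, 0) := hν.1
    simp only [tr, Nat.mul_zero, this]
    rfl
  let P : ℕ → Prop := fun b => (tr b).tgt = none
  -- Until the machine leaves the front node, the input counter is one less than the number of
  -- marks; from then on, it moves along the control graph.
  have inv : ∀ b ≤ B, ∃ m, Nat.count P (b + 1) = m + 1 ∧
      (((tr b).tgt = none ∧ st b = Function.update (fun _ => 0) 0 m) ∨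
        ∃ x, (tr b).tgt = some x ∧
          p.Reach (p.entry, Function.update (fun _ => 0) 0 m) (x, st b)) := by
    intro b
    induction b with
    | zero =>
      intro _
      refine ⟨0, ?_, .inl ⟨ht0, hs0⟩⟩
      simp [Nat.count_succ, P, ht0]
    | succ b ih =>
      intro hb
      obtain ⟨m, hm, h⟩ := ih (by omega)
      obtain ⟨r, o, he, hr⟩ := hstep b (by omega)
      rw [Nat.count_succ, hm]
      have hP : P (b + 1) ↔ (tr (b + 1)).tgt = none := Iff.rfl
      simp only [hP]
      clear hP ih
      generalize (tr b).tgt = x at he h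
      generalize (tr (b + 1)).tgt = y at he
      cases he with
      | input =>
        refine ⟨m + 1, by simp, .inl ⟨rfl, ?_⟩⟩
        rcases h with ⟨-, h⟩ | ⟨x, h, -⟩
        · rw [rel_inc.1 hr, h]
          simp
        · cases h
      | enter =>
        refine ⟨m, by simp, .inr ⟨_, rfl, ?_⟩⟩
        rcases h with ⟨-, h⟩ | ⟨x, h, -⟩
        · rw [rel_nop.1 hr, h]
          exact .refl
        · cases h
      | inner he =>
        refine ⟨m, by simp, .inr ⟨_, rfl, ?_⟩⟩
        rcases h with ⟨h, -⟩ | ⟨x, h, h'⟩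
        · cases h
        · cases h
          exact h'.tail ⟨r, o, he, hr⟩
  obtain ⟨m, hm, h⟩ := inv B le_rfl
  have htB : (tr B).tgt = some p.exit := by
    rw [← htr B le_rfl p.bound (by omega), ← ha]
    exact hacc.2
  rcases h with ⟨h, -⟩ | ⟨x, h, h'⟩
  · rw [htB] at h
    cases h
  · obtain rfl : p.exit = x := Option.some.inj (htB.symm.trans h)
    refine ⟨_, (reach_iff p _ _).1 (?_ : p.Reach (p.entry, _) (p.exit, st B))⟩
    have hP : ¬ P B := by simp [P, htB]
    rw [Nat.count_succ, if_neg hP] at hm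
    rw [ha, count_blocks P _ B p.bound le_rfl] at hcount
    · obtain rfl : m = n := by omega
      exact h'
    · intro g hg
      have h1 : g / (p.bound + 1) ≤ B := Nat.div_le_div_right (by omega)
      have h2 := htr (g / (p.bound + 1)) h1 (g % (p.bound + 1)) (Nat.mod_lt _ (by omega))
      rw [Nat.div_add_mod] at h2
      change ((ν g).2 : ℕ) = p.bound ∧ (ν g).1.tgt = none ↔ _
      rw [hreg g (by omega), h2]

end Prog

open Prog in
/-- For every partial recursive function there is a queue machine that accepts `n + 1` exactly if
the function is defined at `n`. -/
theorem exists_queueMachine {f : ℕ →. ℕ} (hf : Partrec f) :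
    ∃ (k : ℕ) (M : QueueMachine (k + 1)), Finite M.Node ∧ M.StartsWithZeroTests ∧
      ∀ n, M.Accepts (n + 1) ↔ (f n).Dom := by
  obtain ⟨p, hp⟩ := computes_of_partrec (Nat.Partrec'.part_iff₁.2 hf) (fun _ => 0) 1 (by simp)
  refine ⟨p.bound, p.machine, p.finite_machine_node, p.machine_startsWithZeroTests, fun n => ?_⟩
  have key : ∀ t, p.Rel (Function.update (fun _ => 0) 0 n) t ↔
      ∃ y ∈ f n, t = Function.update (Function.update (fun _ => 0) 0 n) 1 y := by
    intro t
    rw [hp _ fun j hj => Function.update_of_ne (by omega) _ _]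
    simp
  constructor
  · intro h
    obtain ⟨t, ht⟩ := rel_of_machine_accepts h
    obtain ⟨y, hy, -⟩ := (key t).1 ht
    exact Part.dom_iff_mem.2 ⟨y, hy⟩
  · intro h
    obtain ⟨y, hy⟩ := Part.dom_iff_mem.1 h
    exact machine_accepts_of_rel ((key _).2 ⟨y, hy, rfl⟩)

/-! ### Formulas on traces -/

namespace WMTL

variable {m : ℕ}

/-- Satisfaction of a formula at position `i` of a run with `L` moves, given the labels of the
positions and the costs of the moves. -/
def TraceSat (L : ℕ) (lab : ℕ → Finset (Fin m)) (w : ℕ → ℝ≥0) : WMTL 1 m → ℕ → Prop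
  | .atom a, i => a ∈ lab i
  | .not φ, i => ¬ φ.TraceSat L lab w i
  | .or φ ψ, i => φ.TraceSat L lab w i ∨ ψ.TraceSat L lab w i
  | .untl φ _ r c ψ, i => ∃ j, i < j ∧ j ≤ L ∧ ψ.TraceSat L lab w j ∧
      (∀ k, i < k → k < j → φ.TraceSat L lab w k) ∧ r.Holds (∑ k ∈ Finset.Ico i j, w k) c

/-- The suffix of a run from position `i` on is evaluated on the data of the whole run. -/
theorem sat_iff_traceSat {A : PTA 1 1 m} {L : ℕ} {st : ℕ → A.Config} {w : ℕ → ℝ≥0}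
    (φ : WMTL 1 m) (i : ℕ) (ρ : A.Run) (hL : i + ρ.length = L)
    (hst : ∀ j, ρ.state j = st (i + j))
    (hw : ∀ j, ρ.delay j * A.locCost 0 (ρ.state j.castSucc).1 + A.edgeCost 0 (ρ.edge j) =
      w (i + j)) :
    φ.Sat ρ ↔ φ.TraceSat L (fun j => A.label (st j).1) w i := by
  induction φ generalizing i ρ with
  | atom a => simp only [Sat, TraceSat, hst, Fin.val_zero, Nat.add_zero]
  | not φ ih => simp only [Sat, TraceSat, ih i ρ hL hst hw]
  | or φ ψ ih₁ ih₂ => simp only [Sat, TraceSat, ih₁ i ρ hL hst hw, ih₂ i ρ hL hst hw]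
  | untl φ q r c ψ ih₁ ih₂ =>
    have hrec : ∀ π : Fin (ρ.length + 1), i + π + (ρ.startingAt π).length = L := by
      intro π
      have := π.2
      simp only [PTA.Run.startingAt]
      omega
    have hrec2 : ∀ (π : Fin (ρ.length + 1)) j, (ρ.startingAt π).state j = st (i + π + j) := by
      intro π j
      simp only [PTA.Run.startingAt, hst]
      congr 1
      simp only [Nat.add_assoc]
    have hrec3 : ∀ (π : Fin (ρ.length + 1)) j, (ρ.startingAt π).delay j * A.locCost 0
        ((ρ.startingAt π).state j.castSucc).1 + A.edgeCost 0 ((ρ.startingAt π).edge j) =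
          w (i + π + j) := by
      intro π j
      have h1 : (π : ℕ) + j < ρ.length := by
        have h2 : (j : ℕ) < ρ.length - π := j.2
        omega
      have := hw ⟨π + j, h1⟩
      rw [Nat.add_assoc]
      exact this
    have h1 := fun π : Fin (ρ.length + 1) =>
      ih₁ (i + π) (ρ.startingAt π) (hrec π) (hrec2 π) (hrec3 π)
    have h2 := fun π : Fin (ρ.length + 1) =>
      ih₂ (i + π) (ρ.startingAt π) (hrec π) (hrec2 π) (hrec3 π)
    have hc : ∀ π : Fin (ρ.length + 1),
        (ρ.upTo π).cost q = ∑ k ∈ Finset.Ico i (i + π), w k := by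
      intro π
      obtain rfl : q = 0 := Subsingleton.elim _ _
      rw [Finset.sum_Ico_eq_sum_range, Nat.add_sub_cancel_left, Finset.sum_range]
      refine Finset.sum_congr rfl fun j _ => ?_
      have h3 : (j : ℕ) < ρ.length := by
        have h4 : (j : ℕ) < π := j.2
        have := π.2
        omega
      exact hw ⟨j, h3⟩
    simp only [Sat, TraceSat, h1, h2, hc]
    constructor
    · rintro ⟨π, hπ, h3, h4, h5⟩
      refine ⟨i + π, ?_, by omega, h3, fun k hk hk' => ?_, h5⟩
      · have : 0 < (π : ℕ) := hπ
        omega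
      · have := h4 ⟨k - i, by omega⟩ (Fin.lt_def.2 (by simp; omega))
          (Fin.lt_def.2 (by simp; omega))
        dsimp only at this
        rwa [show i + (k - i) = k by omega] at this
    · rintro ⟨j, hj, hjL, h3, h4, h5⟩
      have e : i + (j - i) = j := by omega
      refine ⟨⟨j - i, by omega⟩, Fin.lt_def.2 (by simp; omega), ?_, fun π' hπ hπ' => ?_, ?_⟩
      · dsimp only
        rwa [e]
      · refine h4 _ ?_ ?_
        · have : 0 < (π' : ℕ) := hπ
          omega
        · have : (π' : ℕ) < j - i := hπ'
          omega
      · dsimp only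
        rwa [e]

/-- The formula `true`, written with the atomic proposition `a`. -/
def tt (a : Fin m) : WMTL 1 m := .or (.atom a) (.not (.atom a))

/-- Conjunction. -/
def and (φ ψ : WMTL 1 m) : WMTL 1 m := .not (.or (.not φ) (.not ψ))

/-- The disjunction of a list of formulas. -/
def disj (a : Fin m) : List (WMTL 1 m) → WMTL 1 m
  | [] => .not (tt a)
  | φ :: l => .or φ (disj a l)

/-- The conjunction of a list of formulas. -/
def conj (a : Fin m) : List (WMTL 1 m) → WMTL 1 m
  | [] => tt a
  | φ :: l => and φ (conj a l)

/-- There is a next move, and its cost satisfies a constraint. -/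
def nextCost (a : Fin m) (r : Cmp) (c : ℕ) : WMTL 1 m := .untl (.not (tt a)) 0 r c (tt a)

/-- `φ` holds at some strictly later position. -/
def eventually (a : Fin m) (φ : WMTL 1 m) : WMTL 1 m := .untl (tt a) 0 .ge 0 φ

/-- `φ` holds now and at all later positions. -/
def always (a : Fin m) (φ : WMTL 1 m) : WMTL 1 m :=
  .not (.or (.not φ) (eventually a (.not φ)))

/-- There is a next move, and its cost lies in `[3 τ, 3 τ + 3)`. -/
def atLoc (a : Fin m) (τ : ℕ) : WMTL 1 m :=
  and (nextCost a .ge (3 * τ)) (nextCost a .lt (3 * τ + 3))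

open Classical in
/-- The next move reveals that the current location satisfies `P`. -/
noncomputable def loc (a : Fin m) {N : ℕ} (P : Fin N → Prop) : WMTL 1 m :=
  disj a ((Finset.univ.filter P).toList.map fun x : Fin N => atLoc a (x : ℕ))

/-- Whenever a location satisfies `P`, the cost up to the next location satisfying `Q`, if there is
one, is a natural number and at most `D`. -/
noncomputable def check (a : Fin m) {N : ℕ} (D : ℕ) (P Q : Fin N → Prop) : WMTL 1 m :=
  always a (.or (.not (loc a P)) (.or (.not (eventually a (loc a Q)))
    (disj a ((List.range (D + 1)).map fun c => .untl (.not (loc a Q)) 0 .eq c (loc a Q)))))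

open Classical in
/-- In locations satisfying `P`, the cost of waiting is at most `1`. -/
noncomputable def cheap (a : Fin m) {N : ℕ} (P : Fin N → Prop) : WMTL 1 m :=
  always a (.not (disj a ((Finset.univ.filter P).toList.map fun x : Fin N =>
    and (atLoc a x) (nextCost a .gt (3 * x + 1)))))

/-- A location satisfying `Acc` is reached after `n` locations satisfying `Mark`. -/
noncomputable def reach (a : Fin m) {N : ℕ} (Mark Acc : Fin N → Prop) : ℕ → WMTL 1 m
  | 0 => .untl (.not (loc a Mark)) 0 .ge 0 (loc a Acc)
  | n + 1 => .untl (.not (loc a Mark)) 0 .ge 0 (and (loc a Mark) (reach a Mark Acc n))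

section Semantics

variable {L : ℕ} {lab : ℕ → Finset (Fin m)} {w : ℕ → ℝ≥0} (a : Fin m)

theorem traceSat_tt (i : ℕ) : (tt a).TraceSat L lab w i := Classical.em _

theorem traceSat_and {φ ψ : WMTL 1 m} {i : ℕ} :
    (and φ ψ).TraceSat L lab w i ↔ φ.TraceSat L lab w i ∧ ψ.TraceSat L lab w i := by
  simp only [and, TraceSat, not_or, not_not]

theorem traceSat_disj {l : List (WMTL 1 m)} {i : ℕ} :
    (disj a l).TraceSat L lab w i ↔ ∃ φ ∈ l, φ.TraceSat L lab w i := by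
  induction l with
  | nil => simpa [disj, TraceSat] using traceSat_tt a i
  | cons φ l ih => simp [disj, TraceSat, ih]

theorem traceSat_conj {l : List (WMTL 1 m)} {i : ℕ} :
    (conj a l).TraceSat L lab w i ↔ ∀ φ ∈ l, φ.TraceSat L lab w i := by
  induction l with
  | nil => simpa [conj] using traceSat_tt a i
  | cons φ l ih => simp [conj, traceSat_and, ih]

theorem traceSat_nextCost {r : Cmp} {c i : ℕ} :
    (nextCost a r c).TraceSat L lab w i ↔ i < L ∧ r.Holds (w i) c := by
  simp only [nextCost, TraceSat, traceSat_tt, not_true_eq_false, true_and]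
  constructor
  · rintro ⟨j, hij, hj, h, hc⟩
    obtain rfl : j = i + 1 := by
      by_contra hne
      exact h (i + 1) (by omega) (by omega)
    refine ⟨by omega, by simpa using hc⟩
  · rintro ⟨hi, hc⟩
    exact ⟨i + 1, by omega, hi, fun k _ _ => by omega, by simpa using hc⟩

theorem traceSat_untl_ge_zero {φ ψ : WMTL 1 m} {i : ℕ} :
    (untl φ 0 .ge 0 ψ).TraceSat L lab w i ↔ ∃ j, i < j ∧ j ≤ L ∧ ψ.TraceSat L lab w j ∧
      ∀ k, i < k → k < j → φ.TraceSat L lab w k := by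
  simp [TraceSat, Cmp.Holds]

theorem traceSat_eventually {φ : WMTL 1 m} {i : ℕ} :
    (eventually a φ).TraceSat L lab w i ↔ ∃ j, i < j ∧ j ≤ L ∧ φ.TraceSat L lab w j := by
  simp [eventually, traceSat_untl_ge_zero, traceSat_tt]

theorem traceSat_always {φ : WMTL 1 m} {i : ℕ} (hi : i ≤ L) :
    (always a φ).TraceSat L lab w i ↔ ∀ j, i ≤ j → j ≤ L → φ.TraceSat L lab w j := by
  simp only [always, TraceSat, traceSat_eventually, not_or, not_not, not_exists, not_and]
  constructor
  · rintro ⟨h0, h1⟩ j hij hj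
    rcases hij.eq_or_lt with rfl | h
    · exact h0
    · exact h1 j h hj
  · exact fun h => ⟨h i le_rfl hi, fun j hij hj => h j hij.le hj⟩

variable {N : ℕ} {q : ℕ → Fin N}

/-- If the cost of a move lies between three times the number of its source and two more, it
determines the source. -/
theorem traceSat_atLoc (hw : ∀ i < L, 3 * (q i : ℝ≥0) ≤ w i ∧ w i ≤ 3 * q i + 2) {τ i : ℕ} :
    (atLoc a τ).TraceSat L lab w i ↔ i < L ∧ (q i : ℕ) = τ := by
  simp only [atLoc, traceSat_and, traceSat_nextCost, Cmp.Holds]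
  constructor
  · rintro ⟨⟨hi, h1⟩, -, h2⟩
    obtain ⟨h3, h4⟩ := hw i hi
    refine ⟨hi, ?_⟩
    have h5 : ((3 * τ : ℕ) : ℝ≥0) < (3 * q i + 3 : ℕ) := by
      refine (h1.trans h4).trans_lt ?_
      push_cast
      gcongr
      norm_num
    have h6 : ((3 * q i : ℕ) : ℝ≥0) < (3 * τ + 3 : ℕ) := by
      refine lt_of_le_of_lt ?_ h2
      push_cast
      exact h3
    have := Nat.cast_lt.1 h5
    have := Nat.cast_lt.1 h6
    omega
  · rintro ⟨hi, rfl⟩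
    obtain ⟨h3, h4⟩ := hw i hi
    refine ⟨⟨hi, ?_⟩, hi, ?_⟩
    · push_cast
      exact h3
    · push_cast
      refine h4.trans_lt ?_
      gcongr
      norm_num

theorem traceSat_loc (hw : ∀ i < L, 3 * (q i : ℝ≥0) ≤ w i ∧ w i ≤ 3 * q i + 2) {P : Fin N → Prop}
    {i : ℕ} : (loc a P).TraceSat L lab w i ↔ i < L ∧ P (q i) := by
  simp only [loc, traceSat_disj, List.mem_map, Finset.mem_toList, Finset.mem_filter,
    Finset.mem_univ, true_and]
  constructor
  · rintro ⟨_, ⟨x, hx, rfl⟩, h⟩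
    rw [traceSat_atLoc a hw] at h
    exact ⟨h.1, by rwa [Fin.ext h.2]⟩
  · rintro ⟨hi, h⟩
    exact ⟨_, ⟨q i, h, rfl⟩, (traceSat_atLoc a hw).2 ⟨hi, rfl⟩⟩

theorem traceSat_check (hw : ∀ i < L, 3 * (q i : ℝ≥0) ≤ w i ∧ w i ≤ 3 * q i + 2)
    {P Q : Fin N → Prop} {D : ℕ} :
    (check a D P Q).TraceSat L lab w 0 ↔ ∀ i < L, P (q i) → (∃ j, i < j ∧ j < L ∧ Q (q j)) →
      ∃ j, i < j ∧ j < L ∧ Q (q j) ∧ (∀ k, i < k → k < j → ¬ Q (q k)) ∧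
        ∃ c ≤ D, ∑ k ∈ Finset.Ico i j, w k = (c : ℕ) := by
  rw [check, traceSat_always a (Nat.zero_le _)]
  simp only [TraceSat, traceSat_loc a hw, traceSat_eventually, traceSat_disj, List.mem_map,
    List.mem_range]
  constructor
  · rintro h i hi hP ⟨j, hij, hj, hQ⟩
    rcases h i (Nat.zero_le _) hi.le with h | h | ⟨_, ⟨c, hc, rfl⟩, h0⟩
    · exact absurd ⟨hi, hP⟩ h
    · exact absurd ⟨j, hij, hj.le, hj, hQ⟩ h
    · obtain ⟨j, hij, -, hQ, h1, h2⟩ := h0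
      obtain ⟨hj, hQ⟩ := (traceSat_loc a hw).1 hQ
      exact ⟨j, hij, hj, hQ, fun k hk hk' hQk => (traceSat_loc a hw).not.1 (h1 k hk hk')
        ⟨hk'.trans hj, hQk⟩, c, by omega, h2⟩
  · intro h i _ _
    by_cases hi : i < L ∧ P (q i)
    · by_cases hj : ∃ j, i < j ∧ j ≤ L ∧ j < L ∧ Q (q j)
      · obtain ⟨j, h1, -, h2, h3⟩ := hj
        obtain ⟨j, h1, h2, h3, h4, c, h5, h6⟩ := h i hi.1 hi.2 ⟨j, h1, h2, h3⟩
        exact .inr (.inr ⟨_, ⟨c, by omega, rfl⟩, j, h1, h2.le, (traceSat_loc a hw).2 ⟨h2, h3⟩,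
          fun k hk hk' => (traceSat_loc a hw).not.2 fun h => h4 k hk hk' h.2, h6⟩)
      · exact .inr (.inl hj)
    · exact .inl hi

theorem traceSat_cheap (hw : ∀ i < L, 3 * (q i : ℝ≥0) ≤ w i ∧ w i ≤ 3 * q i + 2)
    {P : Fin N → Prop} :
    (cheap a P).TraceSat L lab w 0 ↔ ∀ i < L, P (q i) → w i ≤ 3 * q i + 1 := by
  rw [cheap, traceSat_always a (Nat.zero_le _)]
  simp only [TraceSat, traceSat_disj, List.mem_map, Finset.mem_toList, Finset.mem_filter,
    Finset.mem_univ, true_and]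
  constructor
  · intro h i hi hP
    by_contra hlt
    refine h i (Nat.zero_le _) hi.le ⟨_, ⟨q i, hP, rfl⟩, traceSat_and.2
      ⟨(traceSat_atLoc a hw).2 ⟨hi, rfl⟩, (traceSat_nextCost a).2 ⟨hi, ?_⟩⟩⟩
    simpa [Cmp.Holds] using hlt
  · rintro h i - - ⟨_, ⟨x, hx, rfl⟩, h1⟩
    obtain ⟨h1, h2⟩ := traceSat_and.1 h1
    obtain ⟨hi, h1⟩ := (traceSat_atLoc a hw).1 h1
    obtain rfl := Fin.ext h1
    have h3 := ((traceSat_nextCost a).1 h2).2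
    simp only [Cmp.Holds, Nat.cast_add, Nat.cast_mul, Nat.cast_ofNat, Nat.cast_one] at h3
    exact absurd h3 (not_lt.2 (h i hi hx))

theorem count_eq_of_forall_not {P : ℕ → Prop} [DecidablePred P] {i j : ℕ} (hij : i ≤ j)
    (h : ∀ k, i ≤ k → k < j → ¬ P k) : Nat.count P j = Nat.count P i := by
  obtain ⟨d, rfl⟩ := Nat.exists_eq_add_of_le hij
  have h0 := (Nat.count_iff_forall_not (p := fun k => P (i + k)) (n := d)).2
    fun k hk => h (i + k) (by omega) (by omega)
  rw [Nat.count_add, h0, Nat.add_zero]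

open Classical in
/-- The formula `reach n` counts the marked locations. -/
theorem traceSat_reach (hw : ∀ i < L, 3 * (q i : ℝ≥0) ≤ w i ∧ w i ≤ 3 * q i + 2)
    {Mark Acc : Fin N → Prop} {n i : ℕ} :
    (reach a Mark Acc n).TraceSat L lab w i ↔ ∃ j, i < j ∧ j < L ∧ Acc (q j) ∧
      Nat.count (fun k => Mark (q k)) j = Nat.count (fun k => Mark (q k)) (i + 1) + n := by
  induction n generalizing i with
  | zero =>
    simp only [reach, traceSat_untl_ge_zero, TraceSat, traceSat_loc a hw, Nat.add_zero]
    constructor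
    · rintro ⟨j, hij, -, ⟨hj, hA⟩, h⟩
      exact ⟨j, hij, hj, hA, count_eq_of_forall_not hij fun k hk hk' hM =>
        h k hk hk' ⟨hk'.trans hj, hM⟩⟩
    · rintro ⟨j, hij, hj, hA, h⟩
      refine ⟨j, hij, hj.le, ⟨hj, hA⟩, fun k hk hk' hM => ?_⟩
      have h1 := Nat.count_strict_mono (p := fun k => Mark (q k)) hM.2 hk'
      have h2 := Nat.count_monotone (fun k => Mark (q k)) (show i + 1 ≤ k from hk)
      omega
  | succ n ih =>
    simp only [reach, traceSat_untl_ge_zero, TraceSat, traceSat_and, ih]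
    constructor
    · rintro ⟨j, hij, -, ⟨hj, l, hjl, hl, hA, hc⟩, h⟩
      rw [traceSat_loc a hw] at hj
      refine ⟨l, hij.trans hjl, hl, hA, ?_⟩
      rw [hc, Nat.count_succ _ j, if_pos hj.2, count_eq_of_forall_not
        (show i + 1 ≤ j from hij) fun k hk hk' hM =>
          h k hk hk' ((traceSat_loc a hw).2 ⟨hk'.trans hj.1, hM⟩)]
      omega
    · rintro ⟨l, hil, hl, hA, hc⟩
      have hex : ∃ j, i < j ∧ j < l ∧ Mark (q j) := by
        by_contra hne
        push Not at hne
        have := count_eq_of_forall_not (P := fun k => Mark (q k)) (show i + 1 ≤ l from hil)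
          fun k hk hk' => hne k hk hk'
        omega
      have hmin : ∀ k, i < k → k < Nat.find hex → ¬ Mark (q k) := fun k hk hk' hM =>
        Nat.find_min hex hk' ⟨hk, hk'.trans (Nat.find_spec hex).2.1, hM⟩
      obtain ⟨h1, h2, h3⟩ := Nat.find_spec hex
      refine ⟨Nat.find hex, h1, (h2.trans hl).le, ⟨(traceSat_loc a hw).2 ⟨h2.trans hl, h3⟩,
        l, h2, hl, hA, ?_⟩, fun k hk hk' => (traceSat_loc a hw).not.2 fun h => hmin k hk hk' h.2⟩
      rw [hc, Nat.count_succ _ (Nat.find hex), if_pos h3,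
        count_eq_of_forall_not (P := fun k => Mark (q k))
          (show i + 1 ≤ Nat.find hex from h1) fun k hk hk' => hmin k hk hk']
      omega

end Semantics

end WMTL

namespace QueueMachine

/-! ### The automaton of a queue machine -/

variable {K : ℕ} (M : QueueMachine K)

/-- Locations of the automaton: six phases for every node, and a sink `none`. -/
def Location : Type := Option (M.Node × Fin 6)

theorem finite_location [Finite M.Node] : Finite M.Location :=
  inferInstanceAs (Finite (Option (M.Node × Fin 6)))

variable {M} in
/-- The transitions: the phases are run through in order, and one can always escape to the sink. -/
def Location.Succ : M.Location → M.Location → Prop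
  | _, none => True
  | none, some _ => False
  | some (x, i), some (y, j) => (j : ℕ) = i + 1 ∧ y = x ∨ (i : ℕ) = 5 ∧ (j : ℕ) = 0 ∧ M.Succ x y

variable {M} in
/-- The guards: odd phases end when the clock reaches `1`, phases `0` and `4` take a positive amount
of time, and phase `4` of a test for zero takes time `1`. -/
def Location.guard : M.Location → M.Location → Guard 1
  | some (x, i), some _ =>
    match i with
    | 0 => .atom 0 .gt 0
    | 2 => .atom 0 .ge 0
    | 4 => if M.op x = .zero then .atom 0 .eq 1 else .atom 0 .gt 0
    | _ => .atom 0 .eq 1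
  | _, _ => .atom 0 .ge 0

variable {M} in
/-- The clock is reset at the end of odd phases, and when escaping to the sink. -/
def Location.resets : M.Location → M.Location → Bool
  | some (_, i), some _ => (i : ℕ) % 2 = 1
  | _, _ => true

variable {M} in
/-- The cost rates of the six phases. -/
def Location.rate : M.Location → ℕ
  | none => 0
  | some (_, i) => ![2, 1, 1, 0, 1, 1] i

theorem Location.rate_le (l : M.Location) : l.rate ≤ 2 := by
  rcases l with _ | ⟨_, i⟩
  · exact Nat.zero_le _
  · fin_cases i <;> simp [rate]

theorem Location.succ_none (l : M.Location) : l.Succ none := by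
  rcases l with _ | _ <;> trivial

theorem Location.guard_none (l : M.Location) : l.guard none = .atom 0 .ge 0 := by
  rcases l with _ | _ <;> rfl

theorem Location.resets_none (l : M.Location) : l.resets none = true := by
  rcases l with _ | _ <;> rfl

variable [Finite M.Node]

/-- A numbering of the locations. -/
noncomputable def locEquiv : M.Location ≃ Fin (Nat.card M.Location) :=
  have := M.finite_location
  Finite.equivFin _

/-- A numbering of the transitions. -/
noncomputable def edgeEquiv :
    {c : M.Location × M.Location // c.1.Succ c.2} ≃
      Fin (Nat.card {c : M.Location × M.Location // c.1.Succ c.2}) :=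
  have := M.finite_location
  Finite.equivFin _

/-- The automaton of a queue machine. The price of a transition is three times the number of its
source, so that the cost of a move, which includes at most `2` for the delay, reveals the source. -/
noncomputable def automaton (m : ℕ) : PTA 1 1 m where
  numLocs := Nat.card M.Location
  init := M.locEquiv (some (M.start, 0))
  numEdges := Nat.card {c : M.Location × M.Location // c.1.Succ c.2}
  edge i :=
    let c := (M.edgeEquiv.symm i).1
    ⟨M.locEquiv c.1, c.1.guard c.2, if c.1.resets c.2 then {0} else ∅, M.locEquiv c.2⟩
  edge_injective i j h := by
    simp only [Edge.mk.injEq, EmbeddingLike.apply_eq_iff_eq] at h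
    exact M.edgeEquiv.symm.injective (Subtype.ext (Prod.ext h.1 h.2.2.2))
  inv _ := .atom 0 .le 1
  locCost _ q := (M.locEquiv.symm q).rate
  edgeCost _ i := 3 * M.locEquiv (M.edgeEquiv.symm i).1.1
  label _ := ∅

/-- Runs of the automaton, described by the locations, the values of the clock at the positions, and
the delays. -/
structure IsTrace (L : ℕ) (l : ℕ → M.Location) (x δ : ℕ → ℝ≥0) : Prop where
  loc_zero : l 0 = some (M.start, 0)
  clock_zero : x 0 = 0
  succ : ∀ i < L, (l i).Succ (l (i + 1))
  le_one : ∀ i < L, x i + δ i ≤ 1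
  guard : ∀ i < L, ((l i).guard (l (i + 1))).Sat fun _ => x i + δ i
  clock_succ : ∀ i < L, x (i + 1) = if (l i).resets (l (i + 1)) then 0 else x i + δ i

/-- The cost of the `i`-th move of a trace. -/
noncomputable def cost (l : ℕ → M.Location) (δ : ℕ → ℝ≥0) (i : ℕ) : ℝ≥0 :=
  δ i * (l i).rate + 3 * M.locEquiv (l i)

variable {M} in
theorem mixedMove_iff {m : ℕ} {s s' : (M.automaton m).Config} {t : ℝ≥0} {l l' : M.Location}
    (hs : s.1 = M.locEquiv l) (hs' : s'.1 = M.locEquiv l') {i : Fin (M.automaton m).numEdges} :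
    (M.automaton m).MixedMove s t i s' ↔ (M.edgeEquiv.symm i).1 = (l, l') ∧ s.2 0 + t ≤ 1 ∧
      (l.guard l').Sat (fun _ => s.2 0 + t) ∧
      s'.2 0 = if l.resets l' then 0 else s.2 0 + t := by
  obtain ⟨q, v⟩ := s
  obtain ⟨q', v'⟩ := s'
  dsimp only at hs hs'
  subst hs hs'
  have hv : v.delay t = fun _ => v 0 + t := by
    funext j
    obtain rfl := Subsingleton.elim j 0
    rfl
  have hinv : ∀ q (u : Valuation 1), ((M.automaton m).inv q).Sat u ↔ u 0 ≤ 1 := by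
    intro q u
    change u 0 ≤ ((1 : ℕ) : ℝ≥0) ↔ _
    rw [Nat.cast_one]
  have hext : ∀ u u' : Valuation 1, u = u' ↔ u 0 = u' 0 := fun u u' =>
    ⟨fun h => h ▸ rfl, fun h => funext fun j => by rwa [Subsingleton.elim j 0]⟩
  simp only [PTA.MixedMove, PTA.DelayMove, PTA.DiscreteMove]
  constructor
  · rintro ⟨_, ⟨rfl, h1⟩, h2, h3, h4, -⟩
    have e1 : l = (M.edgeEquiv.symm i).1.1 := M.locEquiv.injective h2
    have e2 : l' = (M.edgeEquiv.symm i).1.2 := M.locEquiv.injective (congrArg Prod.fst h4)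
    subst e1 e2
    refine ⟨rfl, (hinv _ _).1 (h1 t le_rfl), hv ▸ h3, ?_⟩
    have h5 := congrFun (congrArg Prod.snd h4) 0
    rw [hv] at h5
    simp only [automaton, Valuation.reset] at h5
    rw [h5]
    split_ifs <;> simp_all
  · rintro ⟨h1, h2, h3, h4⟩
    have e1 : l = (M.edgeEquiv.symm i).1.1 := by rw [h1]
    have e2 : l' = (M.edgeEquiv.symm i).1.2 := by rw [h1]
    subst e1 e2
    refine ⟨_, ⟨rfl, fun t' ht' => (hinv _ _).2 ((add_le_add_right ht' _).trans h2)⟩, rfl,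
      hv ▸ h3, ?_, ?_⟩
    · refine Prod.ext rfl ((hext _ _).2 ?_)
      rw [hv]
      simp only [automaton, Valuation.reset]
      rw [h4]
      split_ifs <;> simp_all
    · refine (hinv _ _).2 ?_
      rw [h4]
      split_ifs
      · exact zero_le_one
      · exact h2

/-- In every state, one can escape to the sink at once. -/
theorem automaton_nonBlocking (m : ℕ) : (M.automaton m).NonBlocking := by
  refine ⟨by simp [automaton, PTA.start, Guard.Sat, Cmp.Holds], fun s hs => ?_⟩
  have h := (M.locEquiv.symm s.1).succ_none
  refine ⟨0, M.edgeEquiv ⟨(M.locEquiv.symm s.1, (none : M.Location)), h⟩,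
    (M.locEquiv (none : M.Location), fun _ => 0), (mixedMove_iff (Equiv.apply_symm_apply _ _).symm
      rfl).2 ⟨congrArg Subtype.val (Equiv.symm_apply_apply _ _), ?_, ?_, ?_⟩⟩
  · rw [add_zero]
    simpa [automaton, Guard.Sat, Cmp.Holds] using hs
  · rw [Location.guard_none]
    simp [Guard.Sat, Cmp.Holds]
  · rw [Location.resets_none]
    rfl

/-- Model checking the automaton means finding a trace that satisfies the formula. -/
theorem models_iff {m : ℕ} {φ : WMTL 1 m} : (M.automaton m).Models φ ↔ ∃ L l x δ,
    M.IsTrace L l x δ ∧ φ.TraceSat L (fun _ => ∅) (M.cost l δ) 0 := by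
  constructor
  · rintro ⟨ρ, h0, hφ⟩
    let st : ℕ → (M.automaton m).Config := fun i =>
      if h : i < ρ.length + 1 then ρ.state ⟨i, h⟩ else (M.automaton m).start
    let l : ℕ → M.Location := fun i => M.locEquiv.symm (st i).1
    let x : ℕ → ℝ≥0 := fun i => (st i).2 0
    let δ : ℕ → ℝ≥0 := fun i => if h : i < ρ.length then ρ.delay ⟨i, h⟩ else 0
    have hst : ∀ j : Fin (ρ.length + 1), ρ.state j = st j := fun j => by
      simp only [st]
      rw [dif_pos j.2]
    have hδ : ∀ j : Fin ρ.length, ρ.delay j = δ j := fun j => by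
      simp only [δ]
      rw [dif_pos j.2]
    have hl : ∀ i, (st i).1 = M.locEquiv (l i) := fun i => (Equiv.apply_symm_apply _ _).symm
    have hst0 : st 0 = (M.automaton m).start := by
      rw [← h0]
      exact (hst 0).symm
    have hmove : ∀ j : Fin ρ.length, (M.edgeEquiv.symm (ρ.edge j)).1 = (l j, l (j + 1)) ∧
        x j + δ j ≤ 1 ∧ ((l j).guard (l (j + 1))).Sat (fun _ => x j + δ j) ∧
        x (j + 1) = if (l j).resets (l (j + 1)) then 0 else x j + δ j := by
      intro j
      have := ρ.move j
      rw [hst, hst, hδ] at this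
      exact (mixedMove_iff (hl _) (hl _)).1 this
    refine ⟨ρ.length, l, x, δ, ⟨?_, ?_, fun i hi => ?_, fun i hi => (hmove ⟨i, hi⟩).2.1,
      fun i hi => (hmove ⟨i, hi⟩).2.2.1, fun i hi => (hmove ⟨i, hi⟩).2.2.2⟩, ?_⟩
    · simp only [l, hst0]
      exact Equiv.symm_apply_apply _ _
    · simp only [x, hst0, PTA.start]
    · have h1 := (M.edgeEquiv.symm (ρ.edge ⟨i, hi⟩)).2
      rwa [(hmove ⟨i, hi⟩).1] at h1
    · refine (WMTL.sat_iff_traceSat (st := st) φ 0 ρ (Nat.zero_add _) (fun j => ?_)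
        fun j => ?_).1 hφ
      · rw [Nat.zero_add, hst]
      · rw [Nat.zero_add, hδ, hst, hl]
        have h1 : (M.edgeEquiv.symm (ρ.edge j)).1.1 = l j := by rw [(hmove j).1]
        simp only [automaton, cost, h1, Equiv.symm_apply_apply]
        push_cast
        rfl
  · rintro ⟨L, l, x, δ, h, hφ⟩
    let ρ : (M.automaton m).Run :=
      { length := L
        state := fun j => (M.locEquiv (l j), fun _ => x j)
        delay := fun j => δ j
        edge := fun j => M.edgeEquiv ⟨(l j, l (j + 1)), h.succ j j.2⟩
        move := fun j => (mixedMove_iff rfl rfl).2 ⟨by simp, h.le_one j j.2, h.guard j j.2,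
          h.clock_succ j j.2⟩ }
    refine ⟨ρ, ?_, (WMTL.sat_iff_traceSat (st := fun i => (M.locEquiv (l i), fun _ => x i)) φ 0 ρ
      (Nat.zero_add _) (fun j => ?_) fun j => ?_).2 hφ⟩
    · simp only [ρ, PTA.start, automaton, Fin.val_zero, h.loc_zero, h.clock_zero]
    · rw [Nat.zero_add]
    · rw [Nat.zero_add]
      simp only [ρ, automaton, cost, Equiv.symm_apply_apply, Fin.val_castSucc]
      push_cast
      rfl

end QueueMachine

namespace QueueMachine

/-! ### The formula of a queue machine -/

variable {K : ℕ} (M : QueueMachine K)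

/-- The locations of phase `p`. -/
def Phase (p : Fin 6) (l : M.Location) : Prop := ∃ y, l = some (y, p)

/-- Phase `5` of the nodes for the counter `r`. -/
def Written (r : ℕ) (l : M.Location) : Prop := ∃ y, l = some (y, 5) ∧ M.reg y = r

/-- The phase at the start of which the total cost, modulo `1`, has to agree with the old value of
the counter. With delays `d` and `f` in the phases `0` and `4`, the total cost at the start of the
phases `1`, `2` and `5` is `2 d`, `d` and `f` modulo `1`. -/
def readPhase : Op → Fin 6
  | .inc => 1
  | .dec => 2
  | _ => 5

/-- The phases at which the nodes for the counter `r` compare with its old value. -/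
def Read (r : ℕ) (l : M.Location) : Prop := ∃ y, l = some (y, readPhase (M.op y)) ∧ M.reg y = r

/-- The phases of increments and decrements at the start of which the total cost has to agree,
modulo `1`, with that at the start of phase `5`. This makes the new value `f` equal to `d` in an
increment and to `2 d` in a decrement. -/
def Prepared (l : M.Location) : Prop :=
  ∃ y, M.op y = .inc ∧ l = some (y, 2) ∨ M.op y = .dec ∧ l = some (y, 1)

/-- The last phase of marked nodes. -/
def MarkLoc (l : M.Location) : Prop := ∃ y, l = some (y, 5) ∧ M.Mark y

/-- The last phase of accepting nodes. -/
def AccLoc (l : M.Location) : Prop := ∃ y, l = some (y, 5) ∧ M.Acc y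

/-- The positions of the trace up to `6 a + 5` run through all phases of `ν 0, …, ν a`. -/
def Follows (L : ℕ) (l : ℕ → M.Location) (ν : ℕ → M.Node) (a : ℕ) : Prop :=
  6 * a + 5 < L ∧ ∀ g ≤ a, ∀ p : Fin 6, l (6 * g + p) = some (ν g, p)

theorem Follows.clock_eq_zero {M : QueueMachine K} {L : ℕ} {l : ℕ → M.Location} {x δ : ℕ → ℝ≥0}
    {ν : ℕ → M.Node} {a : ℕ} (h : M.IsTrace L l x δ)
    (hν : M.Follows L l ν a) {g : ℕ} (hg : g ≤ a) : x (6 * g) = 0 := by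
  rcases g with _ | g
  · exact h.clock_zero
  · have h1 := h.clock_succ (6 * g + 5) (by have := hν.1; omega)
    have e1 : l (6 * g + 5) = some (ν g, 5) := hν.2 g (by omega) 5
    have e2 : l (6 * g + 5 + 1) = some (ν (g + 1), 0) := hν.2 (g + 1) hg 0
    rw [e1, e2] at h1
    exact h1

variable [Finite M.Node]

/-- A number that exceeds the cost of `6 * K` moves. -/
noncomputable def maxCost : ℕ := 6 * K * (3 * Nat.card M.Location + 2)

/-- A predicate on locations, as a predicate on their numbers. -/
def ofLoc (P : M.Location → Prop) (q : Fin (Nat.card M.Location)) : Prop := P (M.locEquiv.symm q)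

/-- The formula expressing that a trace is the encoding of an execution of the queue machine; it
does not depend on the input. The first condition bounds the delay `d` of phase `0` by `1 / 2`, the
second makes the delays of the phases `0` and `2` add up to `1`, and the others tie the delay of
phase `4` to `d` and to the old value of the counter. -/
noncomputable def encodes {m : ℕ} (a : Fin m) : WMTL 1 m :=
  WMTL.conj a (WMTL.cheap a (M.ofLoc (M.Phase 0)) ::
    WMTL.check a M.maxCost (M.ofLoc (M.Phase 0)) (M.ofLoc (M.Phase 3)) ::
    WMTL.check a M.maxCost (M.ofLoc M.Prepared) (M.ofLoc (M.Phase 5)) ::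
    (List.range K).map fun r =>
      WMTL.check a M.maxCost (M.ofLoc (M.Written r)) (M.ofLoc (M.Read r)))

/-- The formula expressing that the queue machine accepts `n`. -/
noncomputable def formula {m : ℕ} (a : Fin m) (n : ℕ) : WMTL 1 m :=
  WMTL.and (M.encodes a) (WMTL.reach a (M.ofLoc M.MarkLoc) (M.ofLoc M.AccLoc) n)

/-- The cost of the first `i` moves. -/
noncomputable def total (l : ℕ → M.Location) (δ : ℕ → ℝ≥0) (i : ℕ) : ℝ :=
  ∑ k ∈ Finset.range i, (M.cost l δ k : ℝ)

/-- After every location satisfying `P`, the cost up to the next location satisfying `Q` is an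
integer. -/
def Linked (L : ℕ) (l : ℕ → M.Location) (δ : ℕ → ℝ≥0) (P Q : M.Location → Prop) : Prop :=
  ∀ i j, P (l i) → i < j → j < L → Q (l j) → (∀ k, i < k → k < j → ¬ Q (l k)) →
    ∃ z : ℤ, M.total l δ j - M.total l δ i = z

variable {M} {L : ℕ} {l : ℕ → M.Location} {x δ : ℕ → ℝ≥0}

theorem cost_bounds (h : M.IsTrace L l x δ) (i : ℕ) (hi : i < L) :
    3 * (M.locEquiv (l i) : ℝ≥0) ≤ M.cost l δ i ∧ M.cost l δ i ≤ 3 * M.locEquiv (l i) + 2 := by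
  refine ⟨le_add_of_nonneg_left zero_le, ?_⟩
  rw [cost, add_comm]
  gcongr
  have h1 : δ i ≤ 1 := le_trans (le_add_of_nonneg_left zero_le) (h.le_one i hi)
  have h2 : ((l i).rate : ℝ≥0) ≤ 2 := by exact_mod_cast Location.rate_le M (l i)
  calc δ i * (l i).rate ≤ 1 * 2 := mul_le_mul' h1 h2
    _ = 2 := one_mul _

theorem total_sub (i j : ℕ) (hij : i ≤ j) :
    M.total l δ j - M.total l δ i = ((∑ k ∈ Finset.Ico i j, M.cost l δ k : ℝ≥0) : ℝ) := by
  rw [total, total, ← Finset.sum_Ico_eq_sub _ hij]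
  push_cast
  rfl

theorem linked_of_traceSat {m : ℕ} {a : Fin m} {D : ℕ} {P Q : M.Location → Prop}
    (h : M.IsTrace L l x δ)
    (hs : (WMTL.check a D (M.ofLoc P) (M.ofLoc Q)).TraceSat L (fun _ => ∅) (M.cost l δ) 0) :
    M.Linked L l δ P Q := by
  rw [WMTL.traceSat_check a (q := fun i => M.locEquiv (l i)) (cost_bounds h)] at hs
  simp only [ofLoc, Equiv.symm_apply_apply] at hs
  intro i j hP hij hj hQ hno
  obtain ⟨j', h1, h2, h3, h4, c, -, h5⟩ := hs i (hij.trans hj) hP ⟨j, hij, hj, hQ⟩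
  obtain rfl : j = j' := by
    rcases lt_trichotomy j j' with h | h | h
    · exact absurd hQ (h4 j hij h)
    · exact h
    · exact absurd h3 (hno j' h1 h)
  refine ⟨c, ?_⟩
  rw [total_sub i j hij.le, h5]
  simp

/-- A link whose target is always found within `6 * K` moves is expressed by the formula. -/
theorem traceSat_of_linked {m : ℕ} {a : Fin m} {P Q : M.Location → Prop}
    (h : M.IsTrace L l x δ) (hl : ∀ i < L, P (l i) → ∃ j, i < j ∧ j ≤ i + 6 * K ∧
      (∀ k, i < k → k < j → k < L → ¬ Q (l k)) ∧
      (j < L → Q (l j) ∧ ∃ z : ℤ, M.total l δ j - M.total l δ i = z)) :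
    (WMTL.check a M.maxCost (M.ofLoc P) (M.ofLoc Q)).TraceSat L (fun _ => ∅) (M.cost l δ) 0 := by
  rw [WMTL.traceSat_check a (q := fun i => M.locEquiv (l i)) (cost_bounds h)]
  simp only [ofLoc, Equiv.symm_apply_apply]
  rintro i hi hP ⟨j', hij', hj', hQ'⟩
  obtain ⟨j, hij, hjK, hno, hj⟩ := hl i hi hP
  have hjL : j < L := by
    by_contra hlt
    exact hno j' hij' (by omega) hj' hQ'
  obtain ⟨hQ, z, hz⟩ := hj hjL
  refine ⟨j, hij, hjL, hQ, fun k h1 h2 => hno k h1 h2 (h2.trans hjL), ?_⟩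
  rw [total_sub i j hij.le] at hz
  have hz0 : 0 ≤ z := by
    have : (0 : ℝ) ≤ z := hz ▸ NNReal.coe_nonneg _
    exact_mod_cast this
  obtain ⟨c, rfl⟩ := Int.eq_ofNat_of_zero_le hz0
  have hz' : ∑ k ∈ Finset.Ico i j, M.cost l δ k = (c : ℝ≥0) := by
    apply NNReal.coe_injective
    rw [hz]
    simp
  refine ⟨c, ?_, hz'⟩
  have hle : (c : ℝ≥0) ≤ (M.maxCost : ℕ) := by
    rw [← hz']
    calc ∑ k ∈ Finset.Ico i j, M.cost l δ k
        ≤ ∑ k ∈ Finset.Ico i j, ((3 * Nat.card M.Location + 2 : ℕ) : ℝ≥0) := by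
          refine Finset.sum_le_sum fun k hk => ?_
          rw [Finset.mem_Ico] at hk
          refine (cost_bounds h k (hk.2.trans hjL)).2.trans ?_
          have := (M.locEquiv (l k)).2
          exact_mod_cast (by omega : 3 * (M.locEquiv (l k) : ℕ) + 2 ≤ 3 * Nat.card M.Location + 2)
      _ = ((j - i) * (3 * Nat.card M.Location + 2) : ℕ) := by
          rw [Finset.sum_const, Nat.card_Ico, nsmul_eq_mul, Nat.cast_mul]
      _ ≤ (M.maxCost : ℕ) := by
          rw [maxCost]
          exact_mod_cast Nat.mul_le_mul_right _ (by omega)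
  exact_mod_cast hle

/-! ### The cost of a trace modulo one -/

theorem total_succ (i : ℕ) : M.total l δ (i + 1) =
    M.total l δ i + δ i * (l i).rate + (3 * M.locEquiv (l i) : ℕ) := by
  rw [total, Finset.sum_range_succ, ← total, cost]
  push_cast
  ring

/-- The clock values and the costs, modulo `1`, in the phases of a node. Here `d`, `e` and `f` are
the delays of the phases `0`, `2` and `4`. -/
structure Profile (S : ℕ → ℝ) (d e f : ℝ) (o : Op) : Prop where
  d_pos : 0 < d
  d_le : d ≤ 1
  e_nonneg : 0 ≤ e
  e_le : e ≤ 1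
  f_pos : 0 < f
  f_le : f ≤ 1
  f_zero : o = .zero → f = 1
  cost_one : ∃ z : ℤ, S 1 - S 0 = 2 * d + z
  cost_two : ∃ z : ℤ, S 2 - S 0 = d + z
  cost_three : ∃ z : ℤ, S 3 - S 0 = d + e + z
  cost_five : ∃ z : ℤ, S 5 - S 0 = d + e + f + z

/-- Besides the profile of a node, this gives the cost of passing through it, modulo `1`. -/
theorem Follows.profile {ν : ℕ → M.Node} {a : ℕ} (h : M.IsTrace L l x δ)
    (hν : M.Follows L l ν a) {g : ℕ} (hg : g ≤ a) :
    Profile (fun i => M.total l δ (6 * g + i)) (x (6 * g + 1)) (x (6 * g + 3)) (x (6 * g + 5))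
      (M.op (ν g)) ∧ (δ (6 * g) : ℝ) = x (6 * g + 1) ∧
      (g < a → ∃ z : ℤ, M.total l δ (6 * (g + 1)) - M.total l δ (6 * g) =
        x (6 * g + 1) + x (6 * g + 3) + z) := by
  have hL := hν.1
  have l0 : l (6 * g) = some (ν g, 0) := hν.2 g hg 0
  have l1 : l (6 * g + 1) = some (ν g, 1) := hν.2 g hg 1
  have l2 : l (6 * g + 2) = some (ν g, 2) := hν.2 g hg 2
  have l3 : l (6 * g + 3) = some (ν g, 3) := hν.2 g hg 3
  have l4 : l (6 * g + 4) = some (ν g, 4) := hν.2 g hg 4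
  have l5 : l (6 * g + 5) = some (ν g, 5) := hν.2 g hg 5
  have x0 := hν.clock_eq_zero h hg
  have x1 := h.clock_succ (6 * g) (by omega)
  have x2 := h.clock_succ (6 * g + 1) (by omega)
  have x3 := h.clock_succ (6 * g + 2) (by omega)
  have x4 := h.clock_succ (6 * g + 3) (by omega)
  have x5 := h.clock_succ (6 * g + 4) (by omega)
  have g0 := h.guard (6 * g) (by omega)
  have g1 := h.guard (6 * g + 1) (by omega)
  have g3 := h.guard (6 * g + 3) (by omega)
  have g4 := h.guard (6 * g + 4) (by omega)
  have b0 := h.le_one (6 * g) (by omega)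
  have b2 := h.le_one (6 * g + 2) (by omega)
  have b4 := h.le_one (6 * g + 4) (by omega)
  simp only [Nat.add_assoc, Nat.reduceAdd, l0, l1, l2, l3, l4, l5] at x1 x2 x3 x4 x5 g0 g1 g3 g4
  have x1' : x (6 * g + 1) = x (6 * g) + δ (6 * g) := x1
  have x2' : x (6 * g + 2) = 0 := x2
  have x3' : x (6 * g + 3) = x (6 * g + 2) + δ (6 * g + 2) := x3
  have x4' : x (6 * g + 4) = 0 := x4
  have x5' : x (6 * g + 5) = x (6 * g + 4) + δ (6 * g + 4) := x5
  have g0' : ((0 : ℕ) : ℝ≥0) < x (6 * g) + δ (6 * g) := g0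
  have g1' : x (6 * g + 1) + δ (6 * g + 1) = (1 : ℕ) := g1
  have g3' : x (6 * g + 3) + δ (6 * g + 3) = (1 : ℕ) := g3
  have g4' : 0 < x (6 * g + 5) ∧ (M.op (ν g) = .zero → x (6 * g + 5) = 1) := by
    rw [x5']
    simp only [Location.guard] at g4
    split_ifs at g4 with ho
    · have g4' : x (6 * g + 4) + δ (6 * g + 4) = (1 : ℕ) := g4
      rw [g4', Nat.cast_one]
      exact ⟨one_pos, fun _ => rfl⟩
    · have g4' : ((0 : ℕ) : ℝ≥0) < x (6 * g + 4) + δ (6 * g + 4) := g4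
      rw [Nat.cast_zero] at g4'
      exact ⟨g4', fun h => absurd h ho⟩
  have s1 := M.total_succ (l := l) (δ := δ) (6 * g)
  have s2 := M.total_succ (l := l) (δ := δ) (6 * g + 1)
  have s3 := M.total_succ (l := l) (δ := δ) (6 * g + 2)
  have s4 := M.total_succ (l := l) (δ := δ) (6 * g + 3)
  have s5 := M.total_succ (l := l) (δ := δ) (6 * g + 4)
  have s6 := M.total_succ (l := l) (δ := δ) (6 * g + 5)
  generalize 3 * (M.locEquiv (l (6 * g)) : ℕ) = n0 at s1
  generalize 3 * (M.locEquiv (l (6 * g + 1)) : ℕ) = n1 at s2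
  generalize 3 * (M.locEquiv (l (6 * g + 2)) : ℕ) = n2 at s3
  generalize 3 * (M.locEquiv (l (6 * g + 3)) : ℕ) = n3 at s4
  generalize 3 * (M.locEquiv (l (6 * g + 4)) : ℕ) = n4 at s5
  generalize 3 * (M.locEquiv (l (6 * g + 5)) : ℕ) = n5 at s6
  have r0 : (l (6 * g)).rate = 2 := by rw [l0]; rfl
  have r1 : (l (6 * g + 1)).rate = 1 := by rw [l1]; rfl
  have r2 : (l (6 * g + 2)).rate = 1 := by rw [l2]; rfl
  have r3 : (l (6 * g + 3)).rate = 0 := by rw [l3]; rfl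
  have r4 : (l (6 * g + 4)).rate = 1 := by rw [l4]; rfl
  have r5 : (l (6 * g + 5)).rate = 1 := by rw [l5]; rfl
  rw [r0] at s1
  rw [r1] at s2
  rw [r2] at s3
  rw [r3] at s4
  rw [r4] at s5
  rw [r5] at s6
  simp only [Nat.add_assoc, Nat.reduceAdd] at s2 s3 s4 s5 s6
  rw [x0, zero_add] at x1' g0' b0
  rw [x2', zero_add] at x3' b2
  rw [x4', zero_add] at x5' b4
  rw [← x1'] at s1 g0' b0 ⊢
  rw [← x3'] at s3 b2
  rw [← x5'] at s5 b4
  have g0'' : (0 : ℝ) < x (6 * g + 1) := by exact_mod_cast g0'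
  have g1'' : (x (6 * g + 1) : ℝ) + δ (6 * g + 1) = 1 := by exact_mod_cast g1'
  push_cast at s1 s2 s3 s4 s5 s6
  refine ⟨⟨g0'', by exact_mod_cast b0, NNReal.coe_nonneg _, by exact_mod_cast b2,
    by exact_mod_cast g4'.1, by exact_mod_cast b4, fun ho => by exact_mod_cast g4'.2 ho,
    ⟨n0, ?_⟩, ⟨1 + n0 + n1, ?_⟩, ⟨1 + n0 + n1 + n2, ?_⟩, ⟨1 + n0 + n1 + n2 + n3 + n4, ?_⟩⟩, rfl,
    fun hga => ⟨2 + n0 + n1 + n2 + n3 + n4 + n5, ?_⟩⟩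
  · push_cast
    simp only [Nat.add_zero]
    linarith
  · push_cast
    simp only [Nat.add_zero]
    linarith
  · push_cast
    simp only [Nat.add_zero]
    linarith
  · push_cast
    simp only [Nat.add_zero]
    linarith
  · have h5 := h.guard (6 * g + 5) (by omega)
    have l6 : l (6 * g + 5 + 1) = some (ν (g + 1), 0) := hν.2 (g + 1) hga 0
    rw [l5, l6] at h5
    have h5' : x (6 * g + 5) + δ (6 * g + 5) = (1 : ℕ) := h5
    have h5'' : (x (6 * g + 5) : ℝ) + δ (6 * g + 5) = 1 := by exact_mod_cast h5'
    rw [Nat.mul_add, Nat.mul_one]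
    push_cast
    linarith

end QueueMachine

namespace QueueMachine

variable {K : ℕ} {M : QueueMachine K}

/-! ### From traces to executions -/

theorem Follows.loc_eq {L : ℕ} {l : ℕ → M.Location} {ν : ℕ → M.Node} {a : ℕ}
    (hν : M.Follows L l ν a) {k : ℕ} (hk : k ≤ 6 * a + 5) :
    l k = some (ν (k / 6), ⟨k % 6, Nat.mod_lt _ (by norm_num)⟩) := by
  have := hν.2 (k / 6) (by omega) ⟨k % 6, Nat.mod_lt _ (by norm_num)⟩
  rwa [show 6 * (k / 6) + ((⟨k % 6, Nat.mod_lt _ (by norm_num)⟩ : Fin 6) : ℕ) = k from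
    Nat.div_add_mod k 6] at this

theorem Follows.phase_iff {L : ℕ} {l : ℕ → M.Location} {ν : ℕ → M.Node} {a : ℕ}
    (hν : M.Follows L l ν a) {k : ℕ} (hk : k ≤ 6 * a + 5) {p : Fin 6} :
    M.Phase p (l k) ↔ k % 6 = p := by
  rw [hν.loc_eq hk]
  constructor
  · rintro ⟨y, hy⟩
    have := (Prod.mk.inj (Option.some.inj hy)).2
    exact congrArg Fin.val this
  · intro h
    exact ⟨_, congrArg some (Prod.ext rfl (Fin.ext h))⟩

/-- Between the phase in which a counter is written and the phase in which it is compared with its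
next value, no other comparison concerns the same counter. -/
theorem Follows.not_read {L : ℕ} {l : ℕ → M.Location} {ν : ℕ → M.Node} {a : ℕ}
    (hν : M.Follows L l ν a) (hp : M.IsPath ν a) {g k : ℕ} (hk : 6 * g + 5 < k)
    (hk' : k < 6 * (g + K) + readPhase (M.op (ν (g + K)))) (hka : k ≤ 6 * a + 5) :
    ¬ M.Read (g % K) (l k) := by
  rintro ⟨y, hy, hr⟩
  rw [hν.loc_eq hka] at hy
  obtain ⟨rfl, hy⟩ := Prod.mk.inj (Option.some.inj hy)
  have h1 : k % 6 = readPhase (M.op (ν (k / 6))) := congrArg Fin.val hy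
  rw [hp.reg_eq (by omega)] at hr
  have h2 := (readPhase (M.op (ν (g + K)))).2
  have h3 : K ∣ k / 6 - g := (Nat.modEq_iff_dvd' (by omega)).1 hr.symm
  have h4 : K ≤ k / 6 - g := Nat.le_of_dvd (by omega) h3
  have h5 : k / 6 = g + K := by omega
  rw [h5] at h1
  omega

open Classical in
theorem count_markLoc {L : ℕ} {l : ℕ → M.Location} {ν : ℕ → M.Node} {a : ℕ}
    (hν : M.Follows L l ν a) : Nat.count (fun k => M.MarkLoc (l k)) (6 * a + 5) =
      Nat.count (fun g => M.Mark (ν g)) a := by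
  refine count_blocks (k := 5) (fun g => M.Mark (ν g)) _ a 5 le_rfl fun k hk => ?_
  rw [hν.loc_eq (by omega)]
  constructor
  · rintro ⟨y, hy, hM⟩
    obtain ⟨rfl, h⟩ := Prod.mk.inj (Option.some.inj hy)
    exact ⟨congrArg Fin.val h, hM⟩
  · rintro ⟨h, hM⟩
    exact ⟨_, congrArg some (Prod.ext rfl (Fin.ext h)), hM⟩

/-- As the sink is never left, a trace that visits phase `5` runs through the nodes of a path. -/
theorem exists_follows {L : ℕ} {l : ℕ → M.Location} {x δ : ℕ → ℝ≥0} (h : M.IsTrace L l x δ) {j : ℕ}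
    (hj : j < L) (h5 : M.Phase 5 (l j)) :
    ∃ ν a, j = 6 * a + 5 ∧ M.Follows L l ν a ∧ M.IsPath ν a := by
  have hne : ∀ i ≤ j, ∃ y p, l i = some (y, p) := by
    intro i hi
    by_contra hno
    have h0 : l i = none := by
      rcases hl : l i with _ | ⟨y, p⟩
      · rfl
      · exact absurd ⟨y, p, hl⟩ hno
    -- the sink is never left
    have h1 : ∀ d, i + d ≤ L → l (i + d) = none := by
      intro d
      induction d with
      | zero => exact fun _ => h0
      | succ d ih =>
        intro hd
        have := h.succ (i + d) (by omega)
        rw [ih (by omega)] at this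
        rcases hl : l (i + d + 1) with _ | _
        · rfl
        · rw [hl] at this
          exact this.elim
    obtain ⟨y, hy⟩ := h5
    have := h1 (j - i) (by omega)
    rw [Nat.add_sub_cancel' hi, hy] at this
    cases this
  let nodeAt : ℕ → M.Node := fun i => match l i with
    | some (y, _) => y
    | none => M.start
  let ν : ℕ → M.Node := fun g => nodeAt (6 * g)
  have hnode : ∀ {i y p}, l i = some (y, p) → nodeAt i = y := fun hl => by simp only [nodeAt, hl]
  have hdiv : ∀ {i : ℕ}, i % 6 = 0 → ν (i / 6) = nodeAt i := fun hi => by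
    simp only [ν, Nat.mul_div_cancel' (Nat.dvd_of_mod_eq_zero hi)]
  have main : ∀ i ≤ j, ∃ p : Fin 6, (p : ℕ) = i % 6 ∧ l i = some (ν (i / 6), p) := by
    intro i
    induction i with
    | zero => exact fun _ => ⟨0, rfl, by rw [hdiv rfl, hnode h.loc_zero, h.loc_zero]⟩
    | succ i ih =>
      intro hi
      obtain ⟨p, hp, hl⟩ := ih (by omega)
      obtain ⟨y, p', hl'⟩ := hne (i + 1) hi
      have hs := h.succ i (by omega)
      rw [hl, hl'] at hs
      have hp6 := p'.2
      rcases hs with ⟨h1, rfl⟩ | ⟨h1, h2, -⟩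
      · refine ⟨p', by omega, ?_⟩
        rw [hl', show (i + 1) / 6 = i / 6 by omega]
      · refine ⟨p', by omega, ?_⟩
        rw [hl', hdiv (by omega), hnode hl']
  obtain ⟨p, hp, hl⟩ := main j le_rfl
  have hj5 : j % 6 = 5 := by
    obtain ⟨y, hy⟩ := h5
    rw [hl] at hy
    rw [← hp, (Prod.mk.inj (Option.some.inj hy)).2]
    rfl
  refine ⟨ν, j / 6, by omega, ⟨by omega, fun g hg p => ?_⟩, hnode h.loc_zero, fun g hg => ?_⟩
  · obtain ⟨p', hp', hl⟩ := main (6 * g + p) (by omega)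
    have e : (6 * g + p) / 6 = g := by omega
    rw [hl, e]
    exact congrArg some (Prod.ext rfl (Fin.ext (by simp only [hp']; omega)))
  · obtain ⟨p, hp, hl⟩ := main (6 * g + 5) (by omega)
    obtain ⟨p', hp', hl'⟩ := main (6 * g + 5 + 1) (by omega)
    have hs := h.succ (6 * g + 5) (by omega)
    rw [hl, hl'] at hs
    rcases hs with ⟨h1, -⟩ | ⟨-, -, h1⟩
    · omega
    · rwa [show (6 * g + 5) / 6 = g by omega, show (6 * g + 5 + 1) / 6 = g + 1 by omega] at h1

/-- The effect of an operation on the encoding `2⁻ⁿ` of the counter value `n`. -/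
def RealRel : Op → ℝ → ℝ → Prop
  | .nop, u, v => v = u
  | .inc, u, v => v = u / 2
  | .dec, u, v => u ≤ 1 / 2 ∧ v = 2 * u
  | .zero, u, v => u = 1 ∧ v = 1

theorem realRel_pow_iff {o : Op} {n k : ℕ} :
    RealRel o ((1 / 2) ^ n) ((1 / 2) ^ k) ↔ o.Rel n k := by
  have hinj : ∀ {i j : ℕ}, (1 / 2 : ℝ) ^ i = (1 / 2) ^ j ↔ i = j := fun {i j} =>
    pow_right_inj₀ (by norm_num) (by norm_num)
  have h1 : ∀ {i : ℕ}, (1 / 2 : ℝ) ^ i = 1 ↔ i = 0 := fun {i} => by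
    rw [← hinj (j := 0), pow_zero]
  cases o
  · exact hinj
  · simp only [RealRel, Op.Rel]
    rw [← hinj, pow_succ]
    ring_nf
  · simp only [RealRel, Op.Rel]
    constructor
    · rintro ⟨-, h⟩
      rw [← hinj, pow_succ, h]
      ring
    · rintro rfl
      rw [pow_succ]
      refine ⟨?_, by ring⟩
      have : (1 / 2 : ℝ) ^ k ≤ 1 := pow_le_one₀ (by norm_num) (by norm_num)
      linarith
  · exact and_congr h1 h1

theorem RealRel.exists_pow {o : Op} {n : ℕ} {v : ℝ} (h : RealRel o ((1 / 2) ^ n) v) :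
    ∃ k : ℕ, v = (1 / 2) ^ k := by
  cases o
  · exact ⟨n, h⟩
  · refine ⟨n + 1, ?_⟩
    rw [pow_succ, show v = (1 / 2) ^ n / 2 from h]
    ring
  · obtain ⟨h1, rfl⟩ := h
    rcases n with _ | n
    · norm_num at h1
    · refine ⟨n, ?_⟩
      rw [pow_succ]
      ring
  · exact ⟨0, by rw [h.2, pow_zero]⟩

/-- A queue of real numbers that starts with ones and develops according to the operations encodes
a queue of counters. -/
theorem exists_counters (hK : 0 < K) {a : ℕ} {f : ℕ → ℝ} {o : ℕ → Op}
    (h0 : ∀ g ≤ a, g < K → f g = 1) (h1 : ∀ g ≤ a, K ≤ g → RealRel (o g) (f (g - K)) (f g)) :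
    ∃ c : ℕ → ℕ, (∀ g ≤ a, g < K → c g = 0) ∧
      ∀ g ≤ a, K ≤ g → (o g).Rel (c (g - K)) (c g) := by
  have hex : ∀ g ≤ a, ∃ n : ℕ, f g = (1 / 2) ^ n := by
    intro g
    induction g using Nat.strong_induction_on with
    | _ g ih =>
      intro hg
      rcases lt_or_ge g K with h | h
      · exact ⟨0, by rw [h0 g hg h, pow_zero]⟩
      · obtain ⟨n, hn⟩ := ih (g - K) (by omega) (by omega)
        have := h1 g hg h
        rw [hn] at this
        exact this.exists_pow
  choose! c hc using hex
  refine ⟨c, fun g hg h => ?_, fun g hg h => ?_⟩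
  · have h2 := hc g hg
    rw [h0 g hg h] at h2
    have : (1 / 2 : ℝ) ^ 0 = (1 / 2) ^ c g := (pow_zero _).trans h2
    exact ((pow_right_inj₀ (by norm_num) (by norm_num)).1 this).symm
  · rw [← realRel_pow_iff, ← hc _ hg, ← hc _ (by omega)]
    exact h1 g hg h

theorem eq_of_sub_eq_int {u v : ℝ} (hu : 0 < u) (hu' : u ≤ 1) (hv : 0 < v) (hv' : v ≤ 1) {z : ℤ}
    (h : u - v = z) : u = v := by
  have h1 : (-1 : ℝ) < z := by linarith
  have h2 : (z : ℝ) < 1 := by linarith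
  have h3 : (-1 : ℤ) < z := by exact_mod_cast h1
  have h4 : z < 1 := by exact_mod_cast h2
  obtain rfl : z = 0 := by omega
  rw [Int.cast_zero] at h
  linarith

variable [Finite M.Node]

theorem traceSat_encodes_iff {m : ℕ} {a : Fin m} {L : ℕ} {l : ℕ → M.Location} {x δ : ℕ → ℝ≥0}
    (h : M.IsTrace L l x δ) :
    (M.encodes a).TraceSat L (fun _ => ∅) (M.cost l δ) 0 ↔
      (∀ i < L, M.Phase 0 (l i) → M.cost l δ i ≤ 3 * M.locEquiv (l i) + 1) ∧
      (WMTL.check a M.maxCost (M.ofLoc (M.Phase 0)) (M.ofLoc (M.Phase 3))).TraceSat L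
        (fun _ => ∅) (M.cost l δ) 0 ∧
      (WMTL.check a M.maxCost (M.ofLoc M.Prepared) (M.ofLoc (M.Phase 5))).TraceSat L
        (fun _ => ∅) (M.cost l δ) 0 ∧
      ∀ r < K, (WMTL.check a M.maxCost (M.ofLoc (M.Written r)) (M.ofLoc (M.Read r))).TraceSat L
        (fun _ => ∅) (M.cost l δ) 0 := by
  have h1 := WMTL.traceSat_cheap (lab := fun _ => ∅) a (q := fun i => M.locEquiv (l i))
    (P := M.ofLoc (M.Phase 0)) (cost_bounds h)
  simp only [ofLoc, Equiv.symm_apply_apply] at h1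
  rw [← h1, encodes, WMTL.traceSat_conj]
  simp only [List.mem_cons, List.mem_map, List.mem_range, forall_eq_or_imp, forall_exists_index,
    and_imp, forall_apply_eq_imp_iff₂]

open Classical in
theorem traceSat_reach_iff {m : ℕ} {a : Fin m} {L : ℕ} {l : ℕ → M.Location} {x δ : ℕ → ℝ≥0}
    (h : M.IsTrace L l x δ) {n : ℕ} :
    (WMTL.reach a (M.ofLoc M.MarkLoc) (M.ofLoc M.AccLoc) n).TraceSat L (fun _ => ∅)
      (M.cost l δ) 0 ↔ ∃ j, 0 < j ∧ j < L ∧ M.AccLoc (l j) ∧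
        Nat.count (fun k => M.MarkLoc (l k)) j = n := by
  have h1 := WMTL.traceSat_reach (lab := fun _ => ∅) a (q := fun i => M.locEquiv (l i))
    (Mark := M.ofLoc M.MarkLoc) (Acc := M.ofLoc M.AccLoc) (cost_bounds h) (n := n) (i := 0)
  simp only [ofLoc, Equiv.symm_apply_apply] at h1
  have h2 : ¬ M.MarkLoc (l 0) := by
    rintro ⟨y, hy, -⟩
    rw [h.loc_zero] at hy
    exact absurd (Prod.mk.inj (Option.some.inj hy)).2 (by decide)
  have h3 : Nat.count (fun k => M.MarkLoc (l k)) (0 + 1) = 0 := by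
    rw [Nat.count_succ, if_neg h2, Nat.count_zero]
  rw [h1, h3, Nat.zero_add]

/-- The delays in phase `4` of a trace satisfying the formula encode an execution's counters. -/
theorem accepts_of_traceSat {m : ℕ} {at0 : Fin m} {L n : ℕ} {l : ℕ → M.Location}
    {x δ : ℕ → ℝ≥0} (hK : 0 < K) (hM : M.StartsWithZeroTests) (h : M.IsTrace L l x δ)
    (hs : (M.formula at0 n).TraceSat L (fun _ => ∅) (M.cost l δ) 0) : M.Accepts n := by
  classical
  obtain ⟨henc, hreach⟩ := WMTL.traceSat_and.1 hs
  obtain ⟨hcheap, h03, hprep, hread⟩ := (traceSat_encodes_iff h).1 henc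
  obtain ⟨j, -, hjL, ⟨y, hy, hacc⟩, hcount⟩ := (traceSat_reach_iff h).1 hreach
  obtain ⟨ν, a, rfl, hν, hp⟩ := exists_follows h hjL ⟨y, hy⟩
  replace h03 := linked_of_traceSat h h03
  replace hprep := linked_of_traceSat h hprep
  replace hread := fun r hr => linked_of_traceSat h (hread r hr)
  have hya : ν a = y := by
    have := hν.2 a le_rfl 5
    exact (Prod.mk.inj (Option.some.inj (this.symm.trans hy))).1
  set S := M.total l δ with hS
  have hL := hν.1
  -- the delay in phase `0` is at most `1 / 2`, and the one in phase `2` complements it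
  have hhalf : ∀ g ≤ a, (x (6 * g + 1) : ℝ) ≤ 1 / 2 := by
    intro g hg
    have h1 := hcheap (6 * g) (by omega) ((hν.phase_iff (by omega)).2 (by simp))
    rw [cost, add_comm, add_le_add_iff_left, show l (6 * g) = some (ν g, 0) from hν.2 g hg 0] at h1
    have h2 : δ (6 * g) * ((2 : ℕ) : ℝ≥0) ≤ 1 := h1
    have h3 : (δ (6 * g) : ℝ) * 2 ≤ 1 := by exact_mod_cast h2
    rw [(hν.profile h hg).2.1] at h3
    linarith
  have hcompl : ∀ g ≤ a, (x (6 * g + 1) : ℝ) + x (6 * g + 3) = 1 := by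
    intro g hg
    obtain ⟨hP, -, -⟩ := hν.profile h hg
    obtain ⟨z, hz⟩ := h03 (6 * g) (6 * g + 3) ((hν.phase_iff (by omega)).2 (by simp)) (by omega)
      (by omega) ((hν.phase_iff (by omega)).2 (by simp)) fun k hk hk' hk3 => by
        have : k % 6 = 3 := (hν.phase_iff (by omega)).1 hk3
        omega
    obtain ⟨z', hz'⟩ := hP.cost_three
    simp only [Nat.add_zero] at hz'
    have h1 := hhalf g hg
    have h2 := hP.d_pos
    have h3 := hP.e_nonneg
    have h4 := hP.e_le
    have e : (x (6 * g + 1) : ℝ) + x (6 * g + 3) = (z - z' : ℤ) := by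
      push_cast
      linarith
    have h5 : (0 : ℤ) < z - z' := by
      have : (0 : ℝ) < (z - z' : ℤ) := by linarith
      exact_mod_cast this
    have h6 : z - z' < 2 := by
      have : ((z - z' : ℤ) : ℝ) < 2 := by linarith
      exact_mod_cast this
    obtain h7 : z - z' = 1 := by omega
    rw [e, h7, Int.cast_one]
  have hbase : ∀ g ≤ a, ∃ z : ℤ, S (6 * g) = z := by
    intro g
    induction g with
    | zero => exact fun _ => ⟨0, by simp [S, total]⟩
    | succ g ih =>
      intro hg
      obtain ⟨z, hz⟩ := ih (by omega)
      obtain ⟨z', hz'⟩ := (hν.profile h (show g ≤ a by omega)).2.2 hg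
      rw [hcompl g (by omega)] at hz'
      refine ⟨z + 1 + z', ?_⟩
      push_cast
      linarith
  have hwritten : ∀ g ≤ a, ∃ z : ℤ, S (6 * g + 5) = x (6 * g + 5) + z := by
    intro g hg
    obtain ⟨z, hz⟩ := hbase g hg
    obtain ⟨z', hz'⟩ := (hν.profile h hg).1.cost_five
    simp only [Nat.add_zero] at hz'
    rw [hcompl g hg] at hz'
    refine ⟨z + 1 + z', ?_⟩
    push_cast
    linarith
  have hprep' : ∀ g ≤ a, ∀ p : ℕ, p < 5 → M.Prepared (l (6 * g + p)) →
      ∃ z : ℤ, S (6 * g + 5) - S (6 * g + p) = z := by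
    intro g hg p hp5 hP
    refine hprep _ _ hP (by omega) (by omega) ((hν.phase_iff (by omega)).2
      (by simp)) fun k hk hk' hk5 => ?_
    have : k % 6 = 5 := (hν.phase_iff (by omega)).1 hk5
    omega
  have hread' : ∀ g, g + K ≤ a → ∃ z : ℤ,
      S (6 * (g + K) + readPhase (M.op (ν (g + K)))) - S (6 * g + 5) = z := by
    intro g hg
    have h1 := (readPhase (M.op (ν (g + K)))).2
    refine hread (g % K) (Nat.mod_lt _ hK) _ _ ⟨_, hν.2 g (by omega) 5, hp.reg_eq (by omega)⟩
      (by omega) (by omega) ⟨_, hν.2 (g + K) hg _, ?_⟩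
      fun k hk hk' => hν.not_read hp hk hk' (by omega)
    rw [hp.reg_eq hg, Nat.add_mod_right]
  obtain ⟨c, hc0, hc⟩ := exists_counters hK (a := a) (f := fun g => (x (6 * g + 5) : ℝ))
    (o := fun g => M.op (ν g))
    (fun g hg hgK => (hν.profile h hg).1.f_zero (hM ν a hp g hg hgK)) (by
      intro g hg hgK
      obtain ⟨g, rfl⟩ := Nat.exists_eq_add_of_le' hgK
      rw [Nat.add_sub_cancel]
      have hP := (hν.profile h hg).1
      have hP' := (hν.profile h (show g ≤ a by omega)).1
      have hh := hhalf _ hg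
      obtain ⟨z0, hz0⟩ := hbase _ hg
      obtain ⟨z1, hz1⟩ := hwritten g (by omega)
      obtain ⟨z2, hz2⟩ := hwritten _ hg
      obtain ⟨z3, hz3⟩ := hread' g hg
      obtain ⟨u1, hu1⟩ := hP.cost_one
      obtain ⟨u2, hu2⟩ := hP.cost_two
      simp only [Nat.add_zero] at hu1 hu2
      have hprepg := hprep' _ hg
      have hd := hP.d_pos
      have hd' := hP.d_le
      have hl : ∀ p : Fin 6, l (6 * (g + K) + p) = some (ν (g + K), p) := hν.2 _ hg
      generalize ho : M.op (ν (g + K)) = o at hz3 hP ⊢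
      cases o with
      | nop =>
        refine eq_of_sub_eq_int hP.f_pos hP.f_le hP'.f_pos hP'.f_le (z := z3 + z1 - z2) ?_
        have hz3' : S (6 * (g + K) + 5) - S (6 * g + 5) = z3 := hz3
        push_cast
        linarith
      | inc =>
        obtain ⟨z4, hz4⟩ := hprepg 2 (by omega) ⟨_, .inl ⟨ho, hl 2⟩⟩
        have hz3' : S (6 * (g + K) + 1) - S (6 * g + 5) = z3 := hz3
        have e1 := eq_of_sub_eq_int (u := 2 * x (6 * (g + K) + 1)) (by linarith) (by linarith)
          hP'.f_pos hP'.f_le (z := z3 + z1 - z0 - u1) (by push_cast; linarith)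
        have e2 := eq_of_sub_eq_int hP.f_pos hP.f_le hd hd' (z := z4 + u2 + z0 - z2)
          (by push_cast; linarith)
        simp only [RealRel]
        linarith
      | dec =>
        obtain ⟨z4, hz4⟩ := hprepg 1 (by omega) ⟨_, .inr ⟨ho, hl 1⟩⟩
        have hz3' : S (6 * (g + K) + 2) - S (6 * g + 5) = z3 := hz3
        have e1 := eq_of_sub_eq_int hd hd' hP'.f_pos hP'.f_le (z := z3 + z1 - z0 - u2)
          (by push_cast; linarith)
        have e2 := eq_of_sub_eq_int hP.f_pos hP.f_le (v := 2 * x (6 * (g + K) + 1)) (by linarith)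
          (by linarith) (z := z4 + u1 + z0 - z2) (by push_cast; linarith)
        simp only [RealRel]
        constructor <;> linarith
      | zero =>
        have hz3' : S (6 * (g + K) + 5) - S (6 * g + 5) = z3 := hz3
        have e1 := hP.f_zero rfl
        have e2 := eq_of_sub_eq_int hP.f_pos hP.f_le hP'.f_pos hP'.f_le (z := z3 + z1 - z2)
          (by push_cast; linarith)
        exact ⟨by rw [← e2, e1], e1⟩)
  refine ⟨ν, c, a, hp, hya ▸ hacc, ?_, hc0, hc⟩
  rw [← hcount, count_markLoc hν]

end QueueMachine

namespace QueueMachine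

variable {K : ℕ} {M : QueueMachine K}

/-! ### From executions to traces -/

/-- The locations of a trace that follows a path of nodes and then escapes to the sink. -/
def pathLoc (ν : ℕ → M.Node) (a i : ℕ) : M.Location :=
  if i ≤ 6 * a + 5 then some (ν (i / 6), ⟨i % 6, Nat.mod_lt _ (by norm_num)⟩) else none

/-- The clock values of a trace with given delays `d g` and `f g` in the phases `0` and `4`. The
delays in the phases `2` are chosen as `1 - d g`. -/
noncomputable def pathClock (d f : ℕ → ℝ≥0) (i : ℕ) : ℝ≥0 :=
  (![0, d (i / 6), 0, 1 - d (i / 6), 0, f (i / 6)] : Fin 6 → ℝ≥0)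
    ⟨i % 6, Nat.mod_lt _ (by norm_num)⟩

/-- The delays of a trace with given delays `d g` and `f g` in the phases `0` and `4`. -/
noncomputable def pathDelay (d f : ℕ → ℝ≥0) (i : ℕ) : ℝ≥0 :=
  (![d (i / 6), 1 - d (i / 6), 1 - d (i / 6), d (i / 6), f (i / 6), 1 - f (i / 6)] : Fin 6 → ℝ≥0)
    ⟨i % 6, Nat.mod_lt _ (by norm_num)⟩

section

variable {ν : ℕ → M.Node} {a : ℕ} {d f : ℕ → ℝ≥0}

theorem pathLoc_apply {g : ℕ} (hg : g ≤ a) (p : Fin 6) :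
    pathLoc ν a (6 * g + p) = some (ν g, p) := by
  have h1 : (6 * g + p : ℕ) / 6 = g := by omega
  have h2 : (6 * g + p : ℕ) % 6 = p := by omega
  exact (if_pos (by omega)).trans (congrArg some (Prod.ext (congrArg ν h1) (Fin.ext h2)))

theorem pathClock_apply (g : ℕ) (p : Fin 6) :
    pathClock d f (6 * g + p) = (![0, d g, 0, 1 - d g, 0, f g] : Fin 6 → ℝ≥0) p := by
  have h1 : (6 * g + p : ℕ) / 6 = g := by omega
  have h2 : (6 * g + p : ℕ) % 6 = p := by omega
  simp only [pathClock, h1, h2]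

theorem pathDelay_apply (g : ℕ) (p : Fin 6) :
    pathDelay d f (6 * g + p) =
      (![d g, 1 - d g, 1 - d g, d g, f g, 1 - f g] : Fin 6 → ℝ≥0) p := by
  have h1 : (6 * g + p : ℕ) / 6 = g := by omega
  have h2 : (6 * g + p : ℕ) % 6 = p := by omega
  simp only [pathDelay, h1, h2]

theorem pathLoc_follows : M.Follows (6 * a + 6) (pathLoc ν a) ν a :=
  ⟨by omega, fun _ hg p => pathLoc_apply hg p⟩

/-- Delays in `(0, 1]` in the phases `0` and `4` can be chosen freely, up to the guard of tests for
zero. -/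
theorem isTrace_path (hp : M.IsPath ν a) (hd : ∀ g ≤ a, 0 < d g ∧ d g ≤ 1)
    (hf : ∀ g ≤ a, 0 < f g ∧ f g ≤ 1) (hz : ∀ g ≤ a, M.op (ν g) = .zero → f g = 1) :
    M.IsTrace (6 * a + 6) (pathLoc ν a) (pathClock d f) (pathDelay d f) := by
  suffices hstep : ∀ i < 6 * a + 6,
      (pathLoc ν a i).Succ (pathLoc ν a (i + 1)) ∧
      pathClock d f i + pathDelay d f i ≤ 1 ∧
      ((pathLoc ν a i).guard (pathLoc ν a (i + 1))).Sat
        (fun _ => pathClock d f i + pathDelay d f i) ∧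
      pathClock d f (i + 1) = if (pathLoc ν a i).resets (pathLoc ν a (i + 1)) then 0
        else pathClock d f i + pathDelay d f i by
    refine ⟨?_, rfl, fun i hi => (hstep i hi).1, fun i hi => (hstep i hi).2.1,
      fun i hi => (hstep i hi).2.2.1, fun i hi => (hstep i hi).2.2.2⟩
    have := pathLoc_apply (ν := ν) (Nat.zero_le a) 0
    rwa [hp.1] at this
  intro i hi
  obtain ⟨g, p, rfl⟩ : ∃ (g : ℕ) (p : Fin 6), i = 6 * g + p :=
    ⟨i / 6, ⟨i % 6, Nat.mod_lt _ (by norm_num)⟩, (Nat.div_add_mod i 6).symm⟩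
  have hg : g ≤ a := by omega
  obtain ⟨hd0, hd1⟩ := hd g hg
  obtain ⟨hf0, hf1⟩ := hf g hg
  have l0 := pathLoc_apply (ν := ν) hg
  have x0 := pathClock_apply (d := d) (f := f) g
  have δ0 := pathDelay_apply (d := d) (f := f) g
  have e1 : 1 - d g + d g = 1 := tsub_add_cancel_of_le hd1
  have e2 : d g + (1 - d g) = 1 := add_tsub_cancel_of_le hd1
  have e3 : f g + (1 - f g) = 1 := add_tsub_cancel_of_le hf1
  have step : ∀ {j : ℕ} {u w : M.Location} {y t y' : ℝ≥0}, pathLoc ν a j = u →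
      pathLoc ν a (j + 1) = w → pathClock d f j = y → pathDelay d f j = t →
      pathClock d f (j + 1) = y' → u.Succ w ∧ y + t ≤ 1 ∧ (u.guard w).Sat (fun _ => y + t) ∧
        y' = (if u.resets w then 0 else y + t) →
      (pathLoc ν a j).Succ (pathLoc ν a (j + 1)) ∧
      pathClock d f j + pathDelay d f j ≤ 1 ∧
      ((pathLoc ν a j).guard (pathLoc ν a (j + 1))).Sat
        (fun _ => pathClock d f j + pathDelay d f j) ∧
      pathClock d f (j + 1) = if (pathLoc ν a j).resets (pathLoc ν a (j + 1)) then 0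
        else pathClock d f j + pathDelay d f j := by
    rintro j _ _ _ _ _ rfl rfl rfl rfl rfl h
    exact h
  have one : ∀ {y : ℝ≥0}, y = 1 → y = ((1 : ℕ) : ℝ≥0) := fun h => h.trans Nat.cast_one.symm
  have pos : ∀ {y : ℝ≥0}, 0 < y → ((0 : ℕ) : ℝ≥0) < y := fun h => by rwa [Nat.cast_zero]
  have nonneg : ∀ {y : ℝ≥0}, ((0 : ℕ) : ℝ≥0) ≤ y := fun {y} => by simp
  fin_cases p
  · exact step (l0 0) (l0 1) (x0 0) (δ0 0) (x0 1)
      ⟨.inl ⟨rfl, rfl⟩, (zero_add (d g)).trans_le hd1, pos (hd0.trans_eq (zero_add (d g)).symm),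
        (zero_add (d g)).symm⟩
  · exact step (l0 1) (l0 2) (x0 1) (δ0 1) (x0 2)
      ⟨.inl ⟨rfl, rfl⟩, e2.le, one e2, rfl⟩
  · exact step (l0 2) (l0 3) (x0 2) (δ0 2) (x0 3)
      ⟨.inl ⟨rfl, rfl⟩, (zero_add (1 - d g)).trans_le tsub_le_self, nonneg,
        (zero_add (1 - d g)).symm⟩
  · exact step (l0 3) (l0 4) (x0 3) (δ0 3) (x0 4)
      ⟨.inl ⟨rfl, rfl⟩, e1.le, one e1, rfl⟩
  · refine step (l0 4) (l0 5) (x0 4) (δ0 4) (x0 5)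
      ⟨.inl ⟨rfl, rfl⟩, (zero_add (f g)).trans_le hf1, ?_, (zero_add (f g)).symm⟩
    by_cases ho : M.op (ν g) = .zero
    · have hguard : Location.guard (M := M) (some (ν g, 4)) (some (ν g, 5)) = .atom 0 .eq 1 :=
        if_pos ho
      rw [hguard]
      exact one ((zero_add (f g)).trans (hz g hg ho))
    · have hguard : Location.guard (M := M) (some (ν g, 4)) (some (ν g, 5)) = .atom 0 .gt 0 :=
        if_neg ho
      rw [hguard]
      exact pos (hf0.trans_eq (zero_add (f g)).symm)
  · have x1 : pathClock d f (6 * g + 5 + 1) = 0 := pathClock_apply (d := d) (f := f) (g + 1) 0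
    rcases hg.lt_or_eq with hga | rfl
    · have l1 : pathLoc ν a (6 * g + 5 + 1) = some (ν (g + 1), 0) :=
        pathLoc_apply (ν := ν) (show g + 1 ≤ a from hga) 0
      exact step (l0 5) l1 (x0 5) (δ0 5) x1 ⟨.inr ⟨rfl, rfl, hp.2 g hga⟩, e3.le, one e3, rfl⟩
    · have l1 : pathLoc ν g (6 * g + 5 + 1) = none := if_neg (by omega)
      exact step (l0 5) l1 (x0 5) (δ0 5) x1 ⟨trivial, e3.le, nonneg, rfl⟩

end

theorem realRel_val {o : Op} {n k : ℕ} (h : o.Rel n k) :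
    RealRel o (((1 / 2) ^ n : ℝ≥0) : ℝ) (((1 / 2) ^ k : ℝ≥0) : ℝ) := by
  push_cast
  exact realRel_pow_iff.2 h

/-- An accepting execution is encoded by the trace with delay `2⁻ⁿ` in phase `4`, where `n` is the
value written to the queue, and delay `2⁻ⁿ` or half of it in phase `0`. -/
theorem exists_trace_of_accepts [Finite M.Node] {m : ℕ} (at0 : Fin m) {n : ℕ} (hK : 0 < K)
    (hM : M.StartsWithZeroTests) (h : M.Accepts n) : ∃ L l x δ, M.IsTrace L l x δ ∧
      (M.formula at0 n).TraceSat L (fun _ => ∅) (M.cost l δ) 0 := by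
  classical
  obtain ⟨ν, c, a, hp, hacc, hcount, hc0, hc⟩ := h
  let f : ℕ → ℝ≥0 := fun g => (1 / 2) ^ c g
  let d : ℕ → ℝ≥0 := fun g => if M.op (ν g) = .inc then f g else f g / 2
  have hf0 : ∀ g, 0 < f g := fun g => pow_pos (by norm_num) _
  have hf1 : ∀ g, f g ≤ 1 := fun g => pow_le_one₀ (by norm_num) (by
    rw [← NNReal.coe_le_coe]
    norm_num)
  have hd0 : ∀ g, 0 < d g := fun g => by
    simp only [d]
    split_ifs
    · exact hf0 g
    · exact half_pos (hf0 g)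
  have hrel : ∀ g, g + K ≤ a → RealRel (M.op (ν (g + K))) (f g) (f (g + K)) := fun g hg => by
    have := hc (g + K) hg (by omega)
    rw [Nat.add_sub_cancel] at this
    exact realRel_val this
  have hinc : ∀ g, M.op (ν g) = .inc → d g = f g := fun g ho => if_pos ho
  have hdec : ∀ g, M.op (ν g) = .dec → (d g : ℝ) = f g / 2 := fun g ho => by
    simp [d, ho]
  have hhalf : ∀ g ≤ a, (d g : ℝ) ≤ 1 / 2 := by
    intro g hg
    by_cases ho : M.op (ν g) = .inc
    · rw [hinc g ho]
      rcases lt_or_ge g K with hgK | hgK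
      · rw [hM ν a hp g hg hgK] at ho
        cases ho
      · obtain ⟨g, rfl⟩ := Nat.exists_eq_add_of_le' hgK
        have h1 := hrel g hg
        rw [ho] at h1
        have h2 : (f (g + K) : ℝ) = f g / 2 := h1
        have h3 : (f g : ℝ) ≤ 1 := hf1 g
        linarith
    · have h1 : d g = f g / 2 := if_neg ho
      have h3 : (f g : ℝ) ≤ 1 := hf1 g
      rw [h1]
      push_cast
      linarith
  have hd1 : ∀ g ≤ a, d g ≤ 1 := fun g hg => by
    have : (d g : ℝ) ≤ 1 := (hhalf g hg).trans (by norm_num)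
    exact this
  have hz : ∀ g ≤ a, M.op (ν g) = .zero → f g = 1 := by
    intro g hg ho
    rcases lt_or_ge g K with hgK | hgK
    · simp only [f, hc0 g hg hgK, pow_zero]
    · have := hc g hg hgK
      rw [ho] at this
      simp only [f, this.2, pow_zero]
  have htr := isTrace_path hp (fun g hg => ⟨hd0 g, hd1 g hg⟩) (fun g _ => ⟨hf0 g, hf1 g⟩) hz
  refine ⟨_, _, _, _, htr, ?_⟩
  have hν := pathLoc_follows (ν := ν) (a := a)
  set l := pathLoc ν a with hl
  set x := pathClock d f with hx
  set δ := pathDelay d f with hδ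
  have hx1 : ∀ g, x (6 * g + 1) = d g := fun g => pathClock_apply g 1
  have hx3 : ∀ g ≤ a, (x (6 * g + 3) : ℝ) = 1 - d g := fun g hg => by
    have h1 : x (6 * g + 3) = 1 - d g := pathClock_apply g 3
    rw [h1, NNReal.coe_sub (hd1 g hg), NNReal.coe_one]
  have hx5 : ∀ g, x (6 * g + 5) = f g := fun g => pathClock_apply g 5
  have hle : ∀ {i y}, l i = some y → i ≤ 6 * a + 5 := fun {i y} h => by
    by_contra hlt
    have h0 : l i = none := if_neg hlt
    rw [h0] at h
    cases h
  set S := M.total l δ with hS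
  have hbase : ∀ g ≤ a, ∃ z : ℤ, S (6 * g) = z := by
    intro g
    induction g with
    | zero => exact fun _ => ⟨0, by simp [S, total]⟩
    | succ g ih =>
      intro hg
      obtain ⟨z, hz⟩ := ih (by omega)
      obtain ⟨z', hz'⟩ := (hν.profile htr (show g ≤ a by omega)).2.2 hg
      rw [hx1, hx3 g (by omega)] at hz'
      refine ⟨z + 1 + z', ?_⟩
      push_cast
      linarith
  have hfive : ∀ g ≤ a, ∃ z : ℤ, S (6 * g + 5) = f g + z := by
    intro g hg
    obtain ⟨z, hz⟩ := hbase g hg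
    obtain ⟨z', hz'⟩ := (hν.profile htr hg).1.cost_five
    simp only [Nat.add_zero, hx1, hx3 g hg, hx5] at hz'
    refine ⟨z + 1 + z', ?_⟩
    push_cast
    linarith
  have hone : ∀ g ≤ a, ∃ z : ℤ, S (6 * g + 1) = 2 * d g + z := by
    intro g hg
    obtain ⟨z, hz⟩ := hbase g hg
    obtain ⟨z', hz'⟩ := (hν.profile htr hg).1.cost_one
    simp only [Nat.add_zero, hx1] at hz'
    refine ⟨z + z', ?_⟩
    push_cast
    linarith
  have htwo : ∀ g ≤ a, ∃ z : ℤ, S (6 * g + 2) = d g + z := by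
    intro g hg
    obtain ⟨z, hz⟩ := hbase g hg
    obtain ⟨z', hz'⟩ := (hν.profile htr hg).1.cost_two
    simp only [Nat.add_zero, hx1] at hz'
    refine ⟨z + z', ?_⟩
    push_cast
    linarith
  refine WMTL.traceSat_and.2 ⟨(traceSat_encodes_iff htr).2 ⟨fun i hi hP => ?_,
    traceSat_of_linked htr fun i hi hP => ?_, traceSat_of_linked htr fun i hi hP => ?_,
    fun r _ => traceSat_of_linked htr fun i hi hP => ?_⟩,
    (traceSat_reach_iff htr).2 ⟨6 * a + 5, by omega, by omega, ⟨ν a, hν.2 a le_rfl 5, hacc⟩, ?_⟩⟩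
  · have h0 : i % 6 = 0 := (hν.phase_iff (by omega)).1 hP
    obtain ⟨g, rfl⟩ := Nat.dvd_of_mod_eq_zero h0
    have hg : g ≤ a := by omega
    have h1 : l (6 * g) = some (ν g, 0) := hν.2 g hg 0
    have h2 : δ (6 * g) = d g := pathDelay_apply g 0
    rw [cost, add_comm, add_le_add_iff_left, h1, h2]
    change d g * ((2 : ℕ) : ℝ≥0) ≤ 1
    have h3 : (d g : ℝ) * 2 ≤ 1 := by linarith [hhalf g hg]
    exact_mod_cast h3
  · have h0 : i % 6 = 0 := (hν.phase_iff (by omega)).1 hP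
    obtain ⟨g, rfl⟩ := Nat.dvd_of_mod_eq_zero h0
    have hg : g ≤ a := by omega
    refine ⟨6 * g + 3, by omega, by omega, fun k hk hk' hkL hQ => ?_, fun _ =>
      ⟨(hν.phase_iff (by omega)).2 (by simp), ?_⟩⟩
    · have : k % 6 = 3 := (hν.phase_iff (by omega)).1 hQ
      omega
    · obtain ⟨z, hz⟩ := (hν.profile htr hg).1.cost_three
      simp only [Nat.add_zero, hx1, hx3 g hg] at hz
      refine ⟨1 + z, ?_⟩
      push_cast
      linarith
  · obtain ⟨y, hy⟩ := hP
    have hia : i ≤ 6 * a + 5 := by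
      rcases hy with ⟨-, hy⟩ | ⟨-, hy⟩ <;> exact hle hy
    rw [hν.loc_eq hia] at hy
    have hg : i / 6 ≤ a := by omega
    have hi5 : i % 6 < 5 := by
      rcases hy with ⟨-, hy⟩ | ⟨-, hy⟩
      · have h := (Prod.mk.inj (Option.some.inj hy)).2
        have : i % 6 = 2 := congrArg Fin.val h
        omega
      · have h := (Prod.mk.inj (Option.some.inj hy)).2
        have : i % 6 = 1 := congrArg Fin.val h
        omega
    refine ⟨6 * (i / 6) + 5, by omega, by omega, fun k hk hk' hkL hQ => ?_, fun _ =>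
      ⟨(hν.phase_iff (by omega)).2 (by simp), ?_⟩⟩
    · have : k % 6 = 5 := (hν.phase_iff (by omega)).1 hQ
      omega
    · obtain ⟨z5, hz5⟩ := hfive _ hg
      rcases hy with ⟨ho, hy⟩ | ⟨ho, hy⟩
      · obtain ⟨rfl, hp'⟩ := Prod.mk.inj (Option.some.inj hy)
        have hp' := congrArg Fin.val hp'
        have hi2 : i % 6 = 2 := hp'
        obtain ⟨z2, hz2⟩ := htwo _ hg
        rw [show 6 * (i / 6) + 2 = i by omega, hinc _ ho] at hz2
        refine ⟨z5 - z2, ?_⟩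
        push_cast
        linarith
      · obtain ⟨rfl, hp'⟩ := Prod.mk.inj (Option.some.inj hy)
        have hp' := congrArg Fin.val hp'
        have hi1 : i % 6 = 1 := hp'
        obtain ⟨z1, hz1⟩ := hone _ hg
        rw [show 6 * (i / 6) + 1 = i by omega, hdec _ ho] at hz1
        refine ⟨z5 - z1, ?_⟩
        push_cast
        linarith
  · obtain ⟨y, hy, hr⟩ := hP
    have hia := hle hy
    rw [hν.loc_eq hia] at hy
    obtain ⟨rfl, hp'⟩ := Prod.mk.inj (Option.some.inj hy)
    have hp' := congrArg Fin.val hp'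
    have hi5 : i % 6 = 5 := hp'
    obtain ⟨g, rfl⟩ : ∃ g, i = 6 * g + 5 := ⟨i / 6, by omega⟩
    have hgi : (6 * g + 5) / 6 = g := by omega
    rw [hgi, hp.reg_eq (by omega)] at hr
    subst hr
    have hph := (readPhase (M.op (ν (g + K)))).2
    refine ⟨6 * (g + K) + readPhase (M.op (ν (g + K))), by omega, by omega,
      fun k hk hk' hkL => hν.not_read hp hk hk' (by omega), fun hj => ⟨?_, ?_⟩⟩
    · refine ⟨_, hν.2 (g + K) (by omega) _, ?_⟩
      rw [hp.reg_eq (by omega), Nat.add_mod_right]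
    · have hgK : g + K ≤ a := by omega
      have h1 := hrel g hgK
      obtain ⟨z, hz⟩ := hfive g (by omega)
      obtain ⟨z1, hz1⟩ := hone _ hgK
      obtain ⟨z2, hz2⟩ := htwo _ hgK
      obtain ⟨z5, hz5⟩ := hfive _ hgK
      generalize ho : M.op (ν (g + K)) = o at h1 ⊢
      cases o with
      | nop =>
        have h2 : (f (g + K) : ℝ) = f g := h1
        refine ⟨z5 - z, ?_⟩
        change S (6 * (g + K) + 5) - _ = _
        push_cast
        linarith
      | inc =>
        have h2 : (f (g + K) : ℝ) = f g / 2 := h1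
        rw [hinc _ ho] at hz1
        refine ⟨z1 - z, ?_⟩
        change S (6 * (g + K) + 1) - _ = _
        push_cast
        linarith
      | dec =>
        have h2 : (f (g + K) : ℝ) = 2 * f g := h1.2
        rw [hdec _ ho] at hz2
        refine ⟨z2 - z, ?_⟩
        change S (6 * (g + K) + 2) - _ = _
        push_cast
        linarith
      | zero =>
        have h2 : (f g : ℝ) = 1 := h1.1
        have h3 : (f (g + K) : ℝ) = 1 := h1.2
        refine ⟨z5 - z, ?_⟩
        change S (6 * (g + K) + 5) - _ = _
        push_cast
        linarith
  · rw [count_markLoc hν, hcount]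

/-- The automaton satisfies the formula for `n` exactly if the queue machine accepts `n`. -/
theorem models_formula_iff [Finite M.Node] {m : ℕ} (a : Fin m) (hK : 0 < K)
    (hM : M.StartsWithZeroTests) (n : ℕ) :
    (M.automaton m).Models (M.formula a n) ↔ M.Accepts n := by
  rw [models_iff]
  exact ⟨fun ⟨_, _, _, _, h, hs⟩ => accepts_of_traceSat hK hM h hs,
    fun h => exists_trace_of_accepts a hK hM h⟩

end QueueMachine

/-! ### The reduction is computable -/

theorem WMTL.code_and {m : ℕ} (φ ψ : WMTL 1 m) :
    (WMTL.and φ ψ).code = [1, 2, 1] ++ φ.code ++ [1] ++ ψ.code := by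
  simp [WMTL.and, WMTL.code]

theorem WMTL.code_reach_succ {m : ℕ} (a : Fin m) {N : ℕ} (Mark Acc : Fin N → Prop) (n : ℕ) :
    (WMTL.reach a Mark Acc (n + 1)).code =
      ([3, 0, Cmp.ge.code, 0] ++ (WMTL.not (WMTL.loc a Mark)).code ++ [1, 2, 1] ++
        (WMTL.loc a Mark).code ++ [1]) ++ (WMTL.reach a Mark Acc n).code := by
  have h : (WMTL.reach a Mark Acc (n + 1)).code = [3, 0, Cmp.ge.code, 0] ++
      ((WMTL.not (WMTL.loc a Mark)).code ++
        (WMTL.and (WMTL.loc a Mark) (WMTL.reach a Mark Acc n)).code) := rfl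
  rw [h, WMTL.code_and]
  simp only [List.append_assoc]

/-- The word for `reach n` consists of `n` copies of a fixed word and the word for `reach 0`. -/
theorem WMTL.computable_code_reach {m : ℕ} (a : Fin m) {N : ℕ} (Mark Acc : Fin N → Prop) :
    Computable fun n => (WMTL.reach a Mark Acc n).code := by
  refine Primrec.to_comp ((Primrec.nat_iterate Primrec.id
    (Primrec.const (WMTL.reach a Mark Acc 0).code) (Primrec.list_append.comp₂ (Primrec₂.const
      ([3, 0, Cmp.ge.code, 0] ++ (WMTL.not (WMTL.loc a Mark)).code ++ [1, 2, 1] ++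
        (WMTL.loc a Mark).code ++ [1])) Primrec₂.right)).of_eq fun n => ?_)
  induction n with
  | zero => rfl
  | succ n ih =>
    rw [WMTL.code_reach_succ, ← ih]
    exact Function.iterate_succ_apply' _ _ _

/-- The instance of the model-checking problem that asks if the queue machine accepts `n`. -/
noncomputable def QueueMachine.toInstance {K : ℕ} (M : QueueMachine K) [Finite M.Node] {m : ℕ}
    (a : Fin m) (n : ℕ) : Instance 1 1 m :=
  (⟨M.automaton m, M.automaton_nonBlocking m⟩, M.formula a n)

theorem QueueMachine.computable_code_toInstance {K : ℕ} (M : QueueMachine K) [Finite M.Node] {m : ℕ}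
    (a : Fin m) : Computable fun n => (M.toInstance a n).code := by
  refine (Computable.list_append.comp (Computable.const ((M.automaton m).code ++
    ([1, 2, 1] ++ (M.encodes a).code ++ [1])))
    (WMTL.computable_code_reach a (M.ofLoc M.MarkLoc) (M.ofLoc M.AccLoc))).of_eq fun n => ?_
  rw [List.append_assoc, ← WMTL.code_and]
  rfl

end Priced

theorem mainTheorem4 (m : ℕ) (hm : 0 < m) :
    ¬ Priced.AlgorithmicallyDecidable (Priced.Instance.code (k := 1) (p := 1) (m := m))
        (fun I : Priced.Instance 1 1 m => I.1.1.Models I.2) := by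
  classical
  rintro ⟨f, hf, hdec⟩
  -- the halting problem for programs without input
  let h : ℕ →. ℕ := fun c => (Denumerable.ofNat Nat.Partrec.Code c).eval 0
  have hh : Partrec h :=
    Nat.Partrec.Code.eval_part.comp (Computable.ofNat Nat.Partrec.Code) (Computable.const 0)
  obtain ⟨k, M, hfin, hM, hacc⟩ := Priced.exists_queueMachine hh
  have key : ∀ c : Nat.Partrec.Code,
      f (M.toInstance ⟨0, hm⟩ (Encodable.encode c + 1)).code = true ↔ (c.eval 0).Dom := by
    intro c
    rw [hdec]
    refine (Priced.QueueMachine.models_formula_iff ⟨0, hm⟩ k.succ_pos hM _).trans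
      ((hacc _).trans ?_)
    simp only [h, Denumerable.ofNat_encode]
  refine ComputablePred.halting_problem 0 ⟨inferInstance, ?_⟩
  refine (hf.comp ((M.computable_code_toInstance ⟨0, hm⟩).comp
    (Computable.succ.comp Computable.encode))).of_eq fun c => ?_
  rw [Bool.eq_iff_iff, decide_eq_true_iff]
  exact key c
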